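/- Theorem 1.3 (improved heat flow estimate, periodic case). Let $\mathbb T^d=\mathbb R^d/\mathbb Z^d$ with Lebesgue measure, and for $f\in L^1(\mathbb T^d)$ let $\hat f(n)=\int_{\mathbb T^d}f(x)e^{-2\pi i n\cdot x}\,dx$, $n\in\mathbb Z^d$; $f$ has mean zero if $\hat f(0)=0$. For $0<\alpha\le 2$ and $t>0$ let $e^{-t|\nabla|^\alpha}f$ be the function with Fourier series $$e^{-t|\nabla|^\alpha}f(x)=\sum_{n\in\mathbb Z^d}e^{-t(2\pi|n|)^\alpha}\hat f(n)e^{2\pi i n\cdot x},$$ where $|n|$ is the Euclidean norm, and write $e^{t\Delta}=e^{-t|\nabla|^2}$. (1) For every $d\ge 1$ and every $0<\alpha<2$ there is a constant $c_1>0$, depending only on $(\alpha,d)$, such that for every $1\le q\le\infty$ and every $f\in L^q(\mathbb T^d)$ with mean zero, $$\|e^{-t|\nabla|^\alpha}f\|_{L^q(\mathbb T^d)}\le e^{-c_1t}\|f\|_{L^q(\mathbb T^d)}\qquad\text{for all }t>0.$$ (2) There is an absolute constant $c_2>0$ such that for every $d\ge 1$, every $1<q<\infty$ and every $f\in L^q(\mathbb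 T^d)$ with mean zero, $$\|e^{t\Delta}f\|_{L^q(\mathbb T^d)}\le e^{-c_2\frac{q-1}{q^2}t}\|f\|_{L^q(\mathbb T^d)}\qquad\text{for all }t>0.$$ -/

import Mathlib

open MeasureTheory
open scoped ENNReal

namespace PeriodicHeat

/-- Lebesgue measure on the torus `ℝᵈ/ℤᵈ`, as the product of the probability Haar measures on the
factors. It is the measure against which `UnitAddTorus.mFourierCoeff` integrates. -/
noncomputable def torusMeasure (d : ℕ) : Measure (UnitAddTorus (Fin d)) :=
  Measure.pi fun _ => AddCircle.haarAddCircle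

theorem torusMeasure_eq_volume (d : ℕ) : torusMeasure d = volume := by
  have h : (volume : Measure UnitAddCircle) = AddCircle.haarAddCircle := by
    have := AddCircle.volume_eq_smul_haarAddCircle (T := 1)
    simpa using this
  simp only [torusMeasure, volume_pi, h]

/-- The Euclidean length `|n|` of a frequency `n ∈ ℤᵈ`. -/
noncomputable def freqNorm {d : ℕ} (n : Fin d → ℤ) : ℝ :=
  Real.sqrt (∑ i, (n i : ℝ) ^ 2)

/-- The Fourier multiplier `e^{-t (2π|n|)^α}` of `e^{-t|∇|^α}`. -/
noncomputable def heatSymbol {d : ℕ} (α t : ℝ) (n : Fin d → ℤ) : ℝ :=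
  Real.exp (-(t * (2 * Real.pi * freqNorm n) ^ α))

/-- The function `e^{-t|∇|^α} f`, given by its Fourier series
`∑ₙ e^{-t (2π|n|)^α} f̂(n) e^{2πi n·x}`. For `α, t > 0` and any `f` the series converges
absolutely, uniformly in `x`. For `α = 2` this is `e^{tΔ} f`. -/
noncomputable def fracHeat {d : ℕ} (α t : ℝ) (f : UnitAddTorus (Fin d) → ℂ) :
    UnitAddTorus (Fin d) → ℂ := fun x =>
  ∑' n : Fin d → ℤ,
    (heatSymbol α t n : ℂ) * UnitAddTorus.mFourierCoeff f n * UnitAddTorus.mFourier n x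

theorem heatSymbol_pos {d : ℕ} (α t : ℝ) (n : Fin d → ℤ) : 0 < heatSymbol α t n :=
  Real.exp_pos _

theorem norm_mFourier_apply {d : ℕ} (n : Fin d → ℤ) (x : UnitAddTorus (Fin d)) :
    ‖UnitAddTorus.mFourier n x‖ = 1 := by
  change ‖∏ i, fourier (n i) (x i)‖ = 1
  rw [norm_prod]
  exact Finset.prod_eq_one fun i _ => Circle.norm_coe _

theorem norm_le_freqNorm {d : ℕ} (n : Fin d → ℤ) :
    ‖(fun i => (n i : ℝ) : Fin d → ℝ)‖ ≤ freqNorm n := by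
  refine (pi_norm_le_iff_of_nonneg (Real.sqrt_nonneg _)).2 fun i => ?_
  refine Real.le_sqrt_of_sq_le ?_
  rw [Real.norm_eq_abs, sq_abs]
  exact Finset.single_le_sum (f := fun i => (n i : ℝ) ^ 2) (fun j _ => sq_nonneg _)
    (Finset.mem_univ i)

theorem summable_heatSymbol {d : ℕ} {α t : ℝ} (hα : 0 < α) (ht : 0 < t) :
    Summable (heatSymbol α t : (Fin d → ℤ) → ℝ) := by
  let L : Submodule ℤ (Fin d → ℝ) := Submodule.span ℤ (Set.range (Pi.basisFun ℝ (Fin d)))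
  have hL : ∀ n : Fin d → ℤ, (fun i => (n i : ℝ)) ∈ L := fun n =>
    ((Pi.basisFun ℝ (Fin d)).mem_span_iff_repr_mem ℤ _).2 fun i => ⟨n i, by simp⟩
  obtain ⟨m, hm⟩ := exists_nat_gt ((Module.finrank ℤ L : ℝ) / α)
  have hr : -(α * m) < -(Module.finrank ℤ L : ℝ) := by
    rw [div_lt_iff₀ hα] at hm
    linarith
  have hs := ZLattice.summable_norm_rpow L _ hr
  have hinj : Function.Injective
      (fun n : Fin d → ℤ => (⟨fun i => (n i : ℝ), hL n⟩ : L)) := by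
    intro a b h
    funext i
    have h1 : ((a i : ℤ) : ℝ) = (b i : ℝ) := congrFun (congrArg Subtype.val h) i
    exact_mod_cast h1
  have hs2 := (hs.comp_injective hinj).mul_left ((m.factorial : ℝ) * (t ^ m)⁻¹)
  refine Summable.of_norm_bounded_eventually hs2 ?_
  refine (Set.finite_singleton (0 : Fin d → ℤ)).subset fun n hn => ?_
  by_contra h0
  refine hn ?_
  have hpos : 0 < ‖(fun i => (n i : ℝ) : Fin d → ℝ)‖ := by
    refine norm_pos_iff.2 fun h => h0 ?_
    funext i
    have := congrFun h i
    simpa using this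
  set z := ‖(fun i => (n i : ℝ) : Fin d → ℝ)‖ with hz
  have hz2 : z ≤ 2 * Real.pi * freqNorm n := by
    have h1 := norm_le_freqNorm n
    have h2 := Real.pi_gt_three
    nlinarith
  have hu : 0 < t * z ^ α := by positivity
  have h3 : heatSymbol α t n ≤ Real.exp (-(t * z ^ α)) := by
    unfold heatSymbol
    gcongr
  have h4 := Real.pow_div_factorial_le_exp (t * z ^ α) hu.le m
  have h5 : Real.exp (-(t * z ^ α)) ≤ ((t * z ^ α) ^ m / m.factorial)⁻¹ := by
    rw [Real.exp_neg]
    exact inv_anti₀ (by positivity) h4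
  have h6 : ((t * z ^ α) ^ m / m.factorial)⁻¹ =
      (m.factorial : ℝ) * (t ^ m)⁻¹ * z ^ (-(α * m)) := by
    rw [Real.rpow_neg hpos.le, Real.rpow_mul hpos.le, Real.rpow_natCast, mul_pow]
    field_simp
  have h7 : ‖heatSymbol α t n‖ = heatSymbol α t n := by
    rw [Real.norm_eq_abs, abs_of_pos (heatSymbol_pos α t n)]
  change ‖heatSymbol α t n‖ ≤ _
  rw [h7]
  exact (h3.trans h5).trans_eq h6

theorem norm_mFourierCoeff_le {d : ℕ} (f : UnitAddTorus (Fin d) → ℂ) (n : Fin d → ℤ) :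
    ‖UnitAddTorus.mFourierCoeff f n‖ ≤ ∫ x, ‖f x‖ ∂torusMeasure d := by
  refine (norm_integral_le_integral_norm _).trans (le_of_eq ?_)
  refine integral_congr_ae (Filter.Eventually.of_forall fun x => ?_)
  simp [norm_mFourier_apply]

/-- The terms of the series defining `fracHeat α t f` are absolutely summable. -/
theorem summable_norm_fracHeat {d : ℕ} {α t : ℝ} (hα : 0 < α) (ht : 0 < t)
    (f : UnitAddTorus (Fin d) → ℂ) :
    Summable fun n : Fin d → ℤ =>
      ‖((heatSymbol α t n : ℂ) * UnitAddTorus.mFourierCoeff f n) • UnitAddTorus.mFourier n‖ := by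
  refine ((summable_heatSymbol hα ht).mul_right (∫ x, ‖f x‖ ∂torusMeasure d)).of_nonneg_of_le
    (fun n => norm_nonneg _) fun n => ?_
  rw [norm_smul, UnitAddTorus.mFourier_norm, mul_one, norm_mul, Complex.norm_real,
    Real.norm_eq_abs, abs_of_pos (heatSymbol_pos α t n)]
  exact mul_le_mul_of_nonneg_left (norm_mFourierCoeff_le f n) (Real.exp_pos _).le

theorem integral_mFourier {d : ℕ} (n : Fin d → ℤ) :
    ∫ x, UnitAddTorus.mFourier n x ∂torusMeasure d = if n = 0 then 1 else 0 := by
  have h := orthonormal_iff_ite.mp (UnitAddTorus.orthonormal_mFourier (d := Fin d)) 0 n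
  simp only [ContinuousMap.inner_toLp, ← UnitAddTorus.mFourier_neg,
    ← UnitAddTorus.mFourier_add] at h
  simp only [neg_zero, add_zero, eq_comm (a := (0 : Fin d → ℤ))] at h
  exact h

/-- `fracHeat α t` acts on Fourier coefficients as multiplication by `e^{-t (2π|n|)^α}`. -/
theorem mFourierCoeff_fracHeat {d : ℕ} {α t : ℝ} (hα : 0 < α) (ht : 0 < t)
    (f : UnitAddTorus (Fin d) → ℂ) (m : Fin d → ℤ) :
    UnitAddTorus.mFourierCoeff (fracHeat α t f) m =
      (heatSymbol α t m : ℂ) * UnitAddTorus.mFourierCoeff f m := by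
  have : IsProbabilityMeasure (torusMeasure d) := by
    unfold torusMeasure; infer_instance
  have hs := summable_norm_fracHeat hα ht f
  set c : (Fin d → ℤ) → ℂ := fun n => (heatSymbol α t n : ℂ) * UnitAddTorus.mFourierCoeff f n
  have key : ∀ x, UnitAddTorus.mFourier (-m) x • fracHeat α t f x =
      ∑' n, c n * UnitAddTorus.mFourier (n + -m) x := by
    intro x
    rw [fracHeat, smul_eq_mul, ← tsum_mul_left]
    refine tsum_congr fun n => ?_
    rw [UnitAddTorus.mFourier_add]
    ring
  have hc : ∀ n k : Fin d → ℤ, ∀ x, ‖c n * UnitAddTorus.mFourier k x‖ = ‖c n‖ := by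
    intro n k x
    rw [norm_mul, norm_mFourier_apply, mul_one]
  have hcs : Summable fun n => ‖c n‖ := by
    refine hs.congr fun n => ?_
    rw [norm_smul, UnitAddTorus.mFourier_norm, mul_one]
  have h1 : UnitAddTorus.mFourierCoeff (fracHeat α t f) m =
      ∫ x, ∑' n, c n * UnitAddTorus.mFourier (n + -m) x ∂torusMeasure d :=
    integral_congr_ae (Filter.Eventually.of_forall key)
  rw [h1, ← integral_tsum_of_summable_integral_norm]
  · simp_rw [integral_const_mul, integral_mFourier]
    rw [tsum_eq_single m]
    · simp [c]
    · intro n hn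
      rw [if_neg (by simpa [← sub_eq_add_neg, sub_eq_zero] using hn), mul_zero]
  · intro n
    refine Integrable.const_mul ?_ _
    refine Integrable.of_bound (UnitAddTorus.mFourier (n + -m)).continuous.aestronglyMeasurable 1
      (Filter.Eventually.of_forall fun x => ?_)
    rw [norm_mFourier_apply]
  · simp only [hc]
    simpa using hcs

end PeriodicHeat

/-! Everything is a norm bound for a Fourier multiplier on trigonometric polynomials without
constant term; `MultiplierBound` is stable under products, sums, integrals, exponentials and
pointwise limits.

Part (1) is subordination. With `β = α / 2`, `s ^ β` is a positive multiple of `∫ (1 - e^{-ls})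
l^{-1-β} dl`, so the fractional flow is an exponential of averaged heat operators. Heat operators
are contractions (`multiplierBound_heat`). On mean zero functions those with `l ≥ l₀` have norm at
most `1 / 2`, with `l₀` independent of `q` (`exists_multiplierBound_heat_half`). The times `l > l₀`
carry positive weight, which gives the factor `e^{-ct}` uniformly in `q`
(`exists_multiplierBound_fracHeat`).

Part (2) is an energy estimate. The vector Stroock–Varopoulos inequality bounds the `L^q`
dissipation of `u` below by `4(q-1)/q²` times the Dirichlet energy of `v = |u|^{q/2-1} u`. The
Poincaré inequality bounds that energy by the variance of `v`. Although `v` need not have mean zero,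
`integral_rpow_le_two_mul_variance` shows that its variance is at least half of `∫ |u|^q`. With
Hölder this bounds the resolvent (`multiplierBound_resolvent`), and powers of resolvents converge to
the heat semigroup (`multiplierBound_heat_decay`).

Density of trigonometric polynomials gives all `q < ∞`, and `q = ∞` follows by letting `p → ∞`. -/

namespace PeriodicHeat

/-! ### Calculus of multiplier bounds -/

section Multiplier

open Filter Topology

variable {ι E : Type*} [NormedAddCommGroup E] [NormedSpace ℂ E]

/-- The Fourier multiplier `m` with respect to the system `e` has norm at most `κ` on the finite
linear combinations of the `e n`. -/
def MultiplierBound (e : ι → E) (κ : ℝ) (m : ι → ℂ) : Prop :=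
  ∀ (S : Finset ι) (c : ι → ℂ), ‖∑ n ∈ S, (m n * c n) • e n‖ ≤ κ * ‖∑ n ∈ S, c n • e n‖

namespace MultiplierBound

variable {e : ι → E} {κ κ' : ℝ} {m m' : ι → ℂ}

theorem mono (h : MultiplierBound e κ m) (hκ : κ ≤ κ') : MultiplierBound e κ' m := fun S c =>
  (h S c).trans (mul_le_mul_of_nonneg_right hκ (norm_nonneg _))

theorem mul (hκ : 0 ≤ κ) (h : MultiplierBound e κ m) (h' : MultiplierBound e κ' m') :
    MultiplierBound e (κ * κ') (m * m') := fun S c => by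
  have h1 := h S (fun n => m' n * c n)
  simp only [← mul_assoc] at h1
  refine h1.trans ?_
  rw [mul_assoc]
  exact mul_le_mul_of_nonneg_left (h' S c) hκ

theorem one (e : ι → E) : MultiplierBound e 1 1 := fun S c => by simp

theorem pow (hκ : 0 ≤ κ) (h : MultiplierBound e κ m) (k : ℕ) :
    MultiplierBound e (κ ^ k) (m ^ k) := by
  induction k with
  | zero => simpa using one e
  | succ k ih => simpa only [pow_succ] using ih.mul (pow_nonneg hκ k) h

theorem add (h : MultiplierBound e κ m) (h' : MultiplierBound e κ' m') :
    MultiplierBound e (κ + κ') (m + m') := fun S c => by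
  simp only [Pi.add_apply, add_mul, add_smul, Finset.sum_add_distrib]
  exact (norm_add_le _ _).trans (add_le_add (h S c) (h' S c))

theorem const_smul (z : ℂ) (h : MultiplierBound e κ m) :
    MultiplierBound e (‖z‖ * κ) (z • m) := fun S c => by
  simp only [Pi.smul_apply, smul_eq_mul, mul_assoc, mul_smul z, ← Finset.smul_sum, norm_smul]
  have := h S c
  simp only [mul_smul] at this ⊢
  exact mul_le_mul_of_nonneg_left this (norm_nonneg z)

theorem finset_sum {J : Type*} (s : Finset J) {κ : J → ℝ} {m : J → ι → ℂ}
    (h : ∀ j ∈ s, MultiplierBound e (κ j) (m j)) :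
    MultiplierBound e (∑ j ∈ s, κ j) (∑ j ∈ s, m j) := by
  classical
  induction s using Finset.induction_on with
  | empty => intro S c; simp
  | insert a s ha ih =>
    rw [Finset.sum_insert ha, Finset.sum_insert ha]
    exact (h a (Finset.mem_insert_self a s)).add
      (ih fun j hj => h j (Finset.mem_insert_of_mem hj))

/-- Each inequality involves finitely many frequencies, so pointwise convergence of the symbols is
enough. -/
theorem of_tendsto {A : Type*} {l : Filter A} [l.NeBot] {K : A → ℝ} {M : A → ι → ℂ}
    (hK : Tendsto K l (𝓝 κ)) (hM : ∀ n, Tendsto (fun a => M a n) l (𝓝 (m n)))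
    (h : ∀ᶠ a in l, MultiplierBound e (K a) (M a)) : MultiplierBound e κ m := fun S c => by
  refine le_of_tendsto_of_tendsto ?_ (hK.mul_const _) (h.mono fun a ha => ha S c)
  exact (tendsto_finsetSum S fun n _ => ((hM n).mul_const _).smul_const _).norm

/-- The exponential is the limit of `(1 + s m / k) ^ k`, whose norm is at most `(1 + s κ / k) ^ k`.
-/
theorem exp {s : ℝ} (hs : 0 ≤ s) (hκ : 0 ≤ κ) (h : MultiplierBound e κ m) :
    MultiplierBound e (Real.exp (s * κ)) (fun n => Complex.exp (s * m n)) := by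
  refine of_tendsto (l := atTop) (K := fun k : ℕ => (1 + s * κ / k) ^ k)
    (M := fun k : ℕ => (1 + ((s / k : ℝ) : ℂ) • m) ^ k) (Real.tendsto_one_add_div_pow_exp _)
    (fun n => ?_) (Eventually.of_forall fun k => ?_)
  · refine (Complex.tendsto_one_add_div_pow_exp (s * m n)).congr fun k => ?_
    simp [div_mul_eq_mul_div]
  · refine MultiplierBound.pow (by positivity) ?_ k
    refine ((one e).add (h.const_smul _)).mono (le_of_eq ?_)
    rw [Complex.norm_real, Real.norm_of_nonneg (by positivity), div_mul_eq_mul_div]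

theorem integral [CompleteSpace E] {X : Type*} [MeasurableSpace X] {ν : Measure X} {K : X → ℝ}
    {M : X → ι → ℂ} (hK : Integrable K ν) (hM : ∀ n, Integrable (fun x => M x n) ν)
    (h : ∀ᵐ x ∂ν, MultiplierBound e (K x) (M x)) :
    MultiplierBound e (∫ x, K x ∂ν) (fun n => ∫ x, M x n ∂ν) := fun S c => by
  have hi : ∀ n ∈ S, Integrable (fun x => (M x n * c n) • e n) ν := fun n _ =>
    ((hM n).mul_const _).smul_const _
  have h1 : ∑ n ∈ S, ((∫ x, M x n ∂ν) * c n) • e n =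
      ∫ x, ∑ n ∈ S, (M x n * c n) • e n ∂ν := by
    rw [integral_finsetSum S hi]
    refine Finset.sum_congr rfl fun n _ => ?_
    rw [integral_smul_const, integral_mul_const]
  rw [h1, ← integral_mul_const]
  exact (norm_integral_le_integral_norm _).trans
    (integral_mono_ae (integrable_finsetSum S hi).norm (hK.mul_const _)
      (h.mono fun x hx => hx S c))

end MultiplierBound

end Multiplier

/-! ### Contractivity of the heat semigroup, and its decay at large times -/

section Torus

open Filter Topology UnitAddTorus

instance isProbabilityMeasure_torusMeasure (d : ℕ) : IsProbabilityMeasure (torusMeasure d) := by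
  unfold torusMeasure; infer_instance

instance isAddLeftInvariant_torusMeasure (d : ℕ) :
    (torusMeasure d).IsAddLeftInvariant := by
  unfold torusMeasure; infer_instance

variable {d : ℕ}

theorem mFourier_apply_add (n : Fin d → ℤ) (x y : UnitAddTorus (Fin d)) :
    mFourier n (x + y) = mFourier n x * mFourier n y := by
  change ∏ i, fourier (n i) ((x + y) i) = (∏ i, fourier (n i) (x i)) * ∏ i, fourier (n i) (y i)
  rw [← Finset.prod_mul_distrib]
  refine Finset.prod_congr rfl fun i _ => ?_
  simp [fourier_apply, AddCircle.toCircle_add]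

/-- The point of the torus at signed distance `h` from the origin along the `j`-th axis. -/
noncomputable def axisPoint (j : Fin d) (h : ℝ) : UnitAddTorus (Fin d) :=
  Pi.single j (h : UnitAddCircle)

theorem mFourier_axisPoint (n : Fin d → ℤ) (j : Fin d) (h : ℝ) :
    mFourier n (axisPoint j h) = Complex.exp ((2 * Real.pi * n j * h : ℝ) * Complex.I) := by
  change ∏ i, fourier (n i) (axisPoint j h i) = _
  rw [Finset.prod_eq_single j]
  · rw [axisPoint, Pi.single_eq_same, fourier_coe_apply]
    congr 1
    push_cast
    ring
  · intro i _ hi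
    rw [axisPoint, Pi.single_eq_of_ne hi, fourier_eval_zero]
  · simp

/-- The symbol of the second difference quotient `-∑ⱼ (u(x + h eⱼ) - 2 u(x) + u(x - h eⱼ)) / h²`. -/
noncomputable def diffSymbol (h : ℝ) (n : Fin d → ℤ) : ℝ :=
  ∑ j, 2 * (1 - Real.cos (2 * Real.pi * n j * h)) / h ^ 2

/-- The symbol `(2π|n|)²` of `-Δ`. -/
noncomputable def laplaceSymbol (n : Fin d → ℤ) : ℝ := ∑ j, (2 * Real.pi * n j) ^ 2

theorem laplaceSymbol_nonneg (n : Fin d → ℤ) : 0 ≤ laplaceSymbol n :=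
  Finset.sum_nonneg fun _ _ => sq_nonneg _

theorem sq_mul_freqNorm (n : Fin d → ℤ) : (2 * Real.pi * freqNorm n) ^ 2 = laplaceSymbol n := by
  rw [mul_pow, freqNorm, Real.sq_sqrt (Finset.sum_nonneg fun _ _ => sq_nonneg _), laplaceSymbol,
    Finset.mul_sum]
  simp only [mul_pow]

theorem heatSymbol_two (t : ℝ) (n : Fin d → ℤ) :
    heatSymbol 2 t n = Real.exp (-(t * laplaceSymbol n)) := by
  rw [heatSymbol, ← sq_mul_freqNorm, Real.rpow_two]

theorem heatSymbol_eq_rpow (α t : ℝ) (n : Fin d → ℤ) :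
    heatSymbol α t n = Real.exp (-(t * laplaceSymbol n ^ (α / 2))) := by
  have h0 : 0 ≤ 2 * Real.pi * freqNorm n :=
    mul_nonneg (by positivity) (Real.sqrt_nonneg _)
  rw [heatSymbol, ← sq_mul_freqNorm, ← Real.rpow_natCast_mul h0]
  congr 4
  push_cast
  ring

theorem four_pi_sq_le_laplaceSymbol {n : Fin d → ℤ} (hn : n ≠ 0) :
    4 * Real.pi ^ 2 ≤ laplaceSymbol n := by
  obtain ⟨j, hj⟩ := Function.ne_iff.mp hn
  have h1 : (1 : ℝ) ≤ (n j : ℝ) ^ 2 := by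
    have : (1 : ℤ) ≤ (n j) ^ 2 := by
      have := sq_pos_of_ne_zero (a := n j) (by simpa using hj)
      omega
    exact_mod_cast this
  refine le_trans ?_ (Finset.single_le_sum (f := fun j => (2 * Real.pi * (n j : ℝ)) ^ 2)
    (fun _ _ => sq_nonneg _) (Finset.mem_univ j))
  nlinarith [sq_nonneg Real.pi]

/-- By the half-angle formula the quotient is four times the squared difference quotient of `sin (a
h / 2)` at `0`. -/
theorem tendsto_two_mul_one_sub_cos_div_sq (a : ℝ) :
    Tendsto (fun h : ℝ => 2 * (1 - Real.cos (a * h)) / h ^ 2) (𝓝[≠] 0) (𝓝 (a ^ 2)) := by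
  have h1 : HasDerivAt (fun h : ℝ => Real.sin (a / 2 * h)) (a / 2) 0 := by
    have := ((hasDerivAt_id (0 : ℝ)).const_mul (a / 2)).sin
    simpa using this
  have h2 := ((hasDerivAt_iff_tendsto_slope.mp h1).pow 2).const_mul 4
  have h3 : 4 * (a / 2) ^ 2 = a ^ 2 := by ring
  rw [h3] at h2
  refine h2.congr' ?_
  filter_upwards [self_mem_nhdsWithin] with h hh
  have hh : h ≠ 0 := hh
  have h4 : Real.cos (a * h) = 1 - 2 * Real.sin (a / 2 * h) ^ 2 := by
    have h5 : a * h = 2 * (a / 2 * h) := by ring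
    rw [h5, Real.cos_two_mul']
    nlinarith [Real.sin_sq_add_cos_sq (a / 2 * h)]
  rw [h4]
  simp only [slope_def_field, mul_zero, Real.sin_zero, sub_zero]
  field_simp
  ring

theorem tendsto_diffSymbol (n : Fin d → ℤ) :
    Tendsto (fun h => diffSymbol h n) (𝓝[≠] 0) (𝓝 (laplaceSymbol n)) :=
  tendsto_finsetSum _ fun j _ => tendsto_two_mul_one_sub_cos_div_sq (2 * Real.pi * n j)

section TrigLp

variable (q : ℝ≥0∞) [Fact (1 ≤ q)]

/-- The monomial `mFourier n` as an element of `L^q`. -/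
noncomputable def monoLp (n : Fin d → ℤ) : Lp ℂ q (torusMeasure d) :=
  ContinuousMap.toLp q (torusMeasure d) ℂ (mFourier n)

theorem norm_monoLp_le (n : Fin d → ℤ) : ‖monoLp q n‖ ≤ 1 := by
  refine (Lp.norm_le_of_ae_bound (C := 1) zero_le_one ?_).trans ?_
  · filter_upwards [ContinuousMap.coeFn_toLp (p := q) (𝕜 := ℂ) (torusMeasure d) (mFourier n)]
      with x hx
    rw [monoLp, hx, norm_mFourier_apply]
  · simp [measureUnivNNReal]

/-- The nonconstant monomials `mFourier n`, as elements of `L^q`. -/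
noncomputable def trigLp (n : {n : Fin d → ℤ // n ≠ 0}) : Lp ℂ q (torusMeasure d) :=
  ContinuousMap.toLp q (torusMeasure d) ℂ (mFourier n.1)

/-- Translation is an isometry of `L^q` and acts diagonally on the monomials. -/
theorem multiplierBound_translation (y : UnitAddTorus (Fin d)) :
    MultiplierBound (trigLp (d := d) q) 1 (fun n => mFourier n.1 y) := by
  have hy : MeasurePreserving (fun x => x + y) (torusMeasure d) (torusMeasure d) :=
    measurePreserving_add_right _ y
  let T := Lp.compMeasurePreservingₗᵢ ℂ (E := ℂ) (p := q) _ hy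
  have hT : ∀ n : {n : Fin d → ℤ // n ≠ 0}, T (trigLp q n) = mFourier n.1 y • trigLp q n := by
    intro n
    apply Lp.ext
    have h1 := Lp.coeFn_compMeasurePreserving (trigLp q n) hy
    have h2 := ContinuousMap.coeFn_toLp (p := q) (𝕜 := ℂ) (torusMeasure d) (mFourier n.1)
    have h3 := hy.quasiMeasurePreserving.ae_eq_comp h2
    refine h1.trans (h3.trans ?_)
    filter_upwards [Lp.coeFn_smul (mFourier n.1 y) (trigLp q n), h2] with x hx hx2
    rw [hx, Pi.smul_apply, smul_eq_mul, trigLp, hx2, Function.comp_apply, mFourier_apply_add,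
      mul_comm]
  intro S c
  rw [one_mul, ← T.norm_map (∑ n ∈ S, c n • trigLp q n), map_sum]
  refine le_of_eq (congrArg _ (Finset.sum_congr rfl fun n _ => ?_))
  rw [map_smul, hT, smul_smul, mul_comm]

/-- The cosine is the symbol of the average of two opposite translations. -/
theorem multiplierBound_cos (j : Fin d) (h : ℝ) :
    MultiplierBound (trigLp (d := d) q) 1
      (fun n => (Real.cos (2 * Real.pi * n.1 j * h) : ℂ)) := by
  have h1 := (((multiplierBound_translation q (axisPoint j h)).const_smul (1 / 2)).add
    ((multiplierBound_translation q (axisPoint j (-h))).const_smul (1 / 2)))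
  have h2 : ‖(1 / 2 : ℂ)‖ * 1 + ‖(1 / 2 : ℂ)‖ * 1 = 1 := by norm_num
  rw [h2] at h1
  convert h1 using 1
  funext n
  simp only [Pi.add_apply, Pi.smul_apply, mFourier_axisPoint, smul_eq_mul, Complex.ofReal_cos,
    Complex.cos, mul_neg, Complex.ofReal_neg]
  ring

/-- Up to the scalar `e^{-2td/h²}` this is the exponential of `2t/h²` times a sum of `d`
contractions, whose norm bound `e^{2td/h²}` the scalar cancels exactly. -/
theorem multiplierBound_exp_diffSymbol {t : ℝ} (ht : 0 ≤ t) (h : ℝ) :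
    MultiplierBound (trigLp (d := d) q) 1
      (fun n => (Real.exp (-(t * diffSymbol h n.1)) : ℂ)) := by
  have h1 := (MultiplierBound.finset_sum Finset.univ fun (j : Fin d) _ =>
    multiplierBound_cos q j h).exp (s := 2 * t / h ^ 2) (by positivity) (by positivity)
  have h2 := h1.const_smul (Real.exp (-(2 * t / h ^ 2 * ∑ j : Fin d, (1 : ℝ))) : ℂ)
  rw [Complex.norm_real, Real.norm_of_nonneg (Real.exp_pos _).le, ← Real.exp_add,
    neg_add_cancel, Real.exp_zero] at h2
  convert h2 using 1
  funext n
  simp only [Pi.smul_apply, smul_eq_mul, Complex.ofReal_exp, ← Complex.exp_add]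
  have h3 : -(t * diffSymbol h n.1) = -(2 * t / h ^ 2 * ∑ j : Fin d, (1 : ℝ)) +
      2 * t / h ^ 2 * ∑ j : Fin d, Real.cos (2 * Real.pi * n.1 j * h) := by
    rw [diffSymbol, Finset.mul_sum, Finset.mul_sum, Finset.mul_sum, ← Finset.sum_neg_distrib,
      ← Finset.sum_neg_distrib, ← Finset.sum_add_distrib]
    refine Finset.sum_congr rfl fun j _ => ?_
    ring
  rw [h3]
  simp only [Finset.sum_apply, Complex.ofReal_add, Complex.ofReal_neg, Complex.ofReal_mul,
    Complex.ofReal_sum, Complex.ofReal_div, Complex.ofReal_pow, Complex.ofReal_ofNat]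

theorem multiplierBound_heat {t : ℝ} (ht : 0 ≤ t) :
    MultiplierBound (trigLp (d := d) q) 1
      (fun n => (Real.exp (-(t * laplaceSymbol n.1)) : ℂ)) := by
  refine MultiplierBound.of_tendsto (l := 𝓝[≠] (0 : ℝ)) tendsto_const_nhds (fun n => ?_)
    (Eventually.of_forall fun h => multiplierBound_exp_diffSymbol q ht h)
  exact (Complex.continuous_ofReal.tendsto _).comp ((Real.continuous_exp.tendsto _).comp
    ((tendsto_diffSymbol n.1).const_mul t).neg)

theorem norm_trigLp_le (n : {n : Fin d → ℤ // n ≠ 0}) : ‖trigLp q n‖ ≤ 1 :=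
  norm_monoLp_le q n.1

theorem norm_mFourierCoeff_le_eLpNorm {f : UnitAddTorus (Fin d) → ℂ} (hf : MemLp f q (torusMeasure d))
    (n : Fin d → ℤ) :
    ‖mFourierCoeff f n‖ ≤ (eLpNorm f q (torusMeasure d)).toReal := by
  refine (norm_mFourierCoeff_le f n).trans ?_
  rw [integral_norm_eq_lintegral_enorm hf.1, ← eLpNorm_one_eq_lintegral_enorm]
  exact ENNReal.toReal_mono hf.2.ne
    (eLpNorm_le_eLpNorm_of_exponent_le Fact.out hf.1)

theorem mFourierCoeff_congr_ae {f g : UnitAddTorus (Fin d) → ℂ} (h : f =ᵐ[torusMeasure d] g)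
    (n : Fin d → ℤ) : mFourierCoeff f n = mFourierCoeff g n := by
  refine integral_congr_ae ?_
  filter_upwards [h] with x hx
  rw [hx]

theorem integrable_mFourier_mul {f : UnitAddTorus (Fin d) → ℂ} (hf : Integrable f (torusMeasure d))
    (n : Fin d → ℤ) : Integrable (fun x => mFourier n x • f x) (torusMeasure d) :=
  hf.bdd_mul (c := 1) (mFourier n).continuous.aestronglyMeasurable
    (Eventually.of_forall fun x => (norm_mFourier_apply n x).le)

/-- The `n`-th Fourier coefficient as a continuous linear functional on `L^q`. -/
noncomputable def coeffCLM (n : Fin d → ℤ) : Lp ℂ q (torusMeasure d) →L[ℂ] ℂ :=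
  LinearMap.mkContinuous
    { toFun := fun f => mFourierCoeff f n
      map_add' := fun f g => by
        have h := mFourierCoeff_congr_ae (Lp.coeFn_add f g) n
        have hf := (Lp.memLp f).integrable Fact.out
        have hg := (Lp.memLp g).integrable Fact.out
        rw [h]
        have := integral_add (integrable_mFourier_mul hf (-n)) (integrable_mFourier_mul hg (-n))
        refine Eq.trans ?_ this
        exact integral_congr_ae (Eventually.of_forall fun x => by simp [mul_add])
      map_smul' := fun z f => by
        have h := mFourierCoeff_congr_ae (Lp.coeFn_smul z f) n
        rw [h]
        have := integral_const_mul (μ := torusMeasure d) z (fun x => mFourier (-n) x • f x)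
        refine Eq.trans ?_ this
        refine integral_congr_ae (Eventually.of_forall fun x => ?_)
        simp only [Pi.smul_apply, smul_eq_mul]
        ring }
    1 fun f => by
      rw [one_mul]
      exact norm_mFourierCoeff_le_eLpNorm q (Lp.memLp f) n

theorem coeffCLM_apply (n : Fin d → ℤ) (f : Lp ℂ q (torusMeasure d)) :
    coeffCLM q n f = mFourierCoeff f n := rfl

theorem norm_coeffCLM_apply_le (n : Fin d → ℤ) (f : Lp ℂ q (torusMeasure d)) :
    ‖coeffCLM q n f‖ ≤ ‖f‖ := norm_mFourierCoeff_le_eLpNorm q (Lp.memLp f) n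

theorem mFourierCoeff_mFourier (m n : Fin d → ℤ) :
    mFourierCoeff (mFourier m) n = if m = n then 1 else 0 := by
  have h := integral_mFourier (m + -n)
  simp only [← sub_eq_add_neg, sub_eq_zero] at h
  rw [← h]
  refine integral_congr_ae (Eventually.of_forall fun x => ?_)
  simp only [smul_eq_mul]
  rw [sub_eq_add_neg, mFourier_add, mul_comm]

theorem coeffCLM_toLp_mFourier (m n : Fin d → ℤ) :
    coeffCLM q n (ContinuousMap.toLp q (torusMeasure d) ℂ (mFourier m)) =
      if m = n then 1 else 0 := by
  rw [coeffCLM_apply, ← mFourierCoeff_mFourier]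
  exact mFourierCoeff_congr_ae (ContinuousMap.coeFn_toLp _ _) n

/-- Taking a Fourier coefficient is a functional of norm at most one on every `L^q`, so the bound
does not depend on `q`. -/
theorem norm_le_norm_sum_trigLp (S : Finset {n : Fin d → ℤ // n ≠ 0})
    (c : {n : Fin d → ℤ // n ≠ 0} → ℂ) {m : {n : Fin d → ℤ // n ≠ 0}} (hm : m ∈ S) :
    ‖c m‖ ≤ ‖∑ n ∈ S, c n • trigLp q n‖ := by
  refine le_of_eq_of_le ?_ (norm_coeffCLM_apply_le q m.1 _)
  rw [map_sum, Finset.sum_eq_single m]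
  · rw [map_smul, trigLp, coeffCLM_toLp_mFourier, if_pos rfl, smul_eq_mul, mul_one]
  · intro n _ hn
    rw [map_smul, trigLp, coeffCLM_toLp_mFourier, if_neg fun h => hn (Subtype.ext h), smul_zero]
  · exact fun h => absurd hm h

theorem multiplierBound_of_sum_le {m : {n : Fin d → ℤ // n ≠ 0} → ℂ} {κ : ℝ}
    (h : ∀ S : Finset {n : Fin d → ℤ // n ≠ 0}, ∑ n ∈ S, ‖m n‖ ≤ κ) :
    MultiplierBound (trigLp (d := d) q) κ m := fun S c => by
  refine (norm_sum_le _ _).trans (le_trans ?_ (mul_le_mul_of_nonneg_right (h S) (norm_nonneg _)))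
  rw [Finset.sum_mul]
  refine Finset.sum_le_sum fun n hn => ?_
  rw [norm_smul, norm_mul]
  refine (mul_le_of_le_one_right (by positivity) (norm_trigLp_le q n)).trans ?_
  exact mul_le_mul_of_nonneg_left (norm_le_norm_sum_trigLp q S c hn) (norm_nonneg _)

/-- At large times even the absolute sum of the symbol over nonzero frequencies is small, and that
sum does not see `q`. -/
theorem exists_multiplierBound_heat_half (d : ℕ) :
    ∃ l₀ : ℝ, 0 < l₀ ∧ ∀ (q : ℝ≥0∞) [Fact (1 ≤ q)] (l : ℝ), l₀ ≤ l →
      MultiplierBound (trigLp (d := d) q) (1 / 2)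
        (fun n => (Real.exp (-(l * laplaceSymbol n.1)) : ℂ)) := by
  have hs := summable_heatSymbol (d := d) (α := 2) (t := 1) two_pos one_pos
  set Z := ∑' n : Fin d → ℤ, heatSymbol 2 1 n with hZ
  have hZ0 : 0 ≤ Z := tsum_nonneg fun n => (heatSymbol_pos 2 1 n).le
  -- One unit of time is kept for summability, giving `Z`. The remaining `l - 1` yields decay
  -- `e^{-(l-1)}`, since nonzero frequencies have symbol at least `1`; and `e^{l-1} ≥ l ≥ 2 * Z`.
  refine ⟨1 + 2 * Z, by positivity, fun q _ l hl => multiplierBound_of_sum_le q fun S => ?_⟩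
  have h1 : ∀ n ∈ S, ‖(Real.exp (-(l * laplaceSymbol n.1)) : ℂ)‖ ≤
      Real.exp (-(l - 1)) * heatSymbol 2 1 n.1 := by
    intro n _
    rw [Complex.norm_real, Real.norm_of_nonneg (Real.exp_pos _).le, heatSymbol_two,
      ← Real.exp_add]
    refine Real.exp_le_exp.mpr ?_
    have h2 := four_pi_sq_le_laplaceSymbol n.2
    have h3 := Real.pi_gt_three
    have h4 : 1 ≤ laplaceSymbol n.1 := by nlinarith
    nlinarith [mul_nonneg (by linarith : 0 ≤ l - 1) (sub_nonneg.mpr h4)]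
  have h4 : ∑ n ∈ S, heatSymbol 2 1 n.1 ≤ Z := by
    have := hs.sum_le_tsum (S.map (Function.Embedding.subtype _))
      (fun n _ => (heatSymbol_pos 2 1 n).le)
    simpa using this
  refine (Finset.sum_le_sum h1).trans ?_
  rw [← Finset.mul_sum, Real.exp_neg]
  have h5 : 2 * Z ≤ Real.exp (l - 1) := by
    have := Real.add_one_le_exp (l - 1)
    linarith
  refine (mul_le_mul_of_nonneg_left h4 (by positivity)).trans ?_
  rw [inv_mul_le_iff₀ (Real.exp_pos _)]
  linarith

end TrigLp

end Torus

/-! ### Subordination of the fractional flow to the heat flow -/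

section Subordination

open Filter Topology Set

variable {β : ℝ}

/-- Near `0` the bound `1 - e^{-l} ≤ l` leaves `l^{-β}`, where `β < 1` is used; at infinity
`l^{-1-β}` suffices, where `β > 0` is used. -/
theorem integrableOn_one_sub_exp_mul_rpow (h0 : 0 < β) (h1 : β < 1) :
    IntegrableOn (fun l : ℝ => (1 - Real.exp (-l)) * l ^ (-1 - β)) (Ioi 0) := by
  have hm : Measurable (fun l : ℝ => (1 - Real.exp (-l)) * l ^ (-1 - β)) := by fun_prop
  rw [← Ioc_union_Ioi_eq_Ioi zero_le_one]
  refine IntegrableOn.union ?_ ?_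
  · have hi : IntegrableOn (fun l : ℝ => l ^ (-β)) (Ioc 0 1) :=
      (intervalIntegrable_iff_integrableOn_Ioc_of_le zero_le_one).mp
        (intervalIntegral.intervalIntegrable_rpow' (by linarith))
    refine hi.mono' hm.aestronglyMeasurable ?_
    filter_upwards [ae_restrict_mem measurableSet_Ioc] with l hl
    have hl0 : 0 < l := hl.1
    have h2 : 0 ≤ 1 - Real.exp (-l) := by
      have : Real.exp (-l) ≤ 1 := Real.exp_le_one_iff.mpr (by linarith)
      linarith
    have h3 : 1 - Real.exp (-l) ≤ l := by
      have := Real.add_one_le_exp (-l)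
      linarith
    rw [Real.norm_of_nonneg (mul_nonneg h2 (Real.rpow_nonneg hl0.le _))]
    refine (mul_le_mul_of_nonneg_right h3 (Real.rpow_nonneg hl0.le _)).trans (le_of_eq ?_)
    rw [show -β = 1 + (-1 - β) by ring, Real.rpow_add hl0, Real.rpow_one]
  · refine (integrableOn_Ioi_rpow_of_lt (a := -1 - β) (by linarith) zero_lt_one).mono'
      hm.aestronglyMeasurable ?_
    filter_upwards [ae_restrict_mem measurableSet_Ioi] with l hl
    have hl0 : 0 < l := lt_trans zero_lt_one hl
    have h2 : 0 ≤ 1 - Real.exp (-l) := by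
      have : Real.exp (-l) ≤ 1 := Real.exp_le_one_iff.mpr (by linarith)
      linarith
    rw [Real.norm_of_nonneg (mul_nonneg h2 (Real.rpow_nonneg hl0.le _))]
    refine mul_le_of_le_one_left (Real.rpow_nonneg hl0.le _) ?_
    linarith [Real.exp_pos (-l)]

/-- The constant in `∫₀^∞ (1 - e^{-λs}) λ^{-1-β} dλ = C s^β`. -/
noncomputable def subordinationConst (β : ℝ) : ℝ :=
  ∫ l in Ioi (0 : ℝ), (1 - Real.exp (-l)) * l ^ (-1 - β)

theorem subordinationConst_pos (h0 : 0 < β) (h1 : β < 1) : 0 < subordinationConst β := by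
  have hpos : ∀ l ∈ Ioi (0 : ℝ), 0 < (1 - Real.exp (-l)) * l ^ (-1 - β) := fun l hl => by
    have hl : 0 < l := hl
    have : Real.exp (-l) < 1 := Real.exp_lt_one_iff.mpr (by linarith)
    exact mul_pos (by linarith) (Real.rpow_pos_of_pos hl _)
  refine (setIntegral_pos_iff_support_of_nonneg_ae ?_
    (integrableOn_one_sub_exp_mul_rpow h0 h1)).mpr ?_
  · filter_upwards [ae_restrict_mem measurableSet_Ioi] with l hl using (hpos l hl).le
  · have : Ioi (0 : ℝ) ⊆
        (Function.support fun l : ℝ => (1 - Real.exp (-l)) * l ^ (-1 - β)) ∩ Ioi 0 :=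
      fun l hl => ⟨(hpos l hl).ne', hl⟩
    exact lt_of_lt_of_le (by simp) (measure_mono this)

theorem one_sub_exp_mul_rpow_eq {s l : ℝ} (hs : 0 < s) (hl : 0 < l) :
    (1 - Real.exp (-(l * s))) * l ^ (-1 - β) =
      s ^ (1 + β) * ((1 - Real.exp (-(s * l))) * (s * l) ^ (-1 - β)) := by
  rw [Real.mul_rpow hs.le hl.le, show -1 - β = -(1 + β) by ring, Real.rpow_neg hs.le, mul_comm l s]
  have := (Real.rpow_pos_of_pos hs (1 + β)).ne'
  field_simp

theorem integrableOn_one_sub_exp_mul_mul_rpow (h0 : 0 < β) (h1 : β < 1) {s : ℝ} (hs : 0 < s) :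
    IntegrableOn (fun l : ℝ => (1 - Real.exp (-(l * s))) * l ^ (-1 - β)) (Ioi 0) := by
  have h2 := (integrableOn_Ioi_comp_mul_left_iff
    (fun l : ℝ => (1 - Real.exp (-l)) * l ^ (-1 - β)) 0 hs).mpr
      (by simpa using integrableOn_one_sub_exp_mul_rpow h0 h1)
  refine IntegrableOn.congr_fun (h2.const_mul (s ^ (1 + β))) (fun l hl => ?_) measurableSet_Ioi
  exact (one_sub_exp_mul_rpow_eq hs hl).symm

theorem integral_one_sub_exp_mul_mul_rpow {s : ℝ} (hs : 0 < s) :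
    ∫ l in Ioi (0 : ℝ), (1 - Real.exp (-(l * s))) * l ^ (-1 - β) =
      subordinationConst β * s ^ β := by
  rw [setIntegral_congr_fun measurableSet_Ioi fun l hl => one_sub_exp_mul_rpow_eq hs hl,
    integral_const_mul,
    integral_comp_mul_left_Ioi (fun l : ℝ => (1 - Real.exp (-l)) * l ^ (-1 - β)) 0 hs, mul_zero,
    smul_eq_mul, Real.rpow_add hs, Real.rpow_one, subordinationConst]
  field_simp

/-- The cutoff is there because `l^{-1-β}` alone is not integrable at `0`; only the truncated
integral can be split into its two terms. -/
theorem tendsto_integral_one_sub_exp_mul_rpow (h0 : 0 < β) (h1 : β < 1) {s : ℝ} (hs : 0 < s) :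
    Tendsto (fun ε : ℝ => ∫ l in Ioi ε, (1 - Real.exp (-(l * s))) * l ^ (-1 - β)) (𝓝[>] 0)
      (𝓝 (subordinationConst β * s ^ β)) := by
  rw [← integral_one_sub_exp_mul_mul_rpow hs]
  have hA : AECover (volume.restrict (Ioi (0 : ℝ))) (𝓝[>] (0 : ℝ)) fun ε => Ioi ε :=
    aecover_Ioi_of_Ioi (tendsto_id'.mpr nhdsWithin_le_nhds)
  refine (hA.integral_tendsto_of_countably_generated
    (integrableOn_one_sub_exp_mul_mul_rpow h0 h1 hs)).congr' ?_
  filter_upwards [self_mem_nhdsWithin] with ε hε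
  have hε : 0 < ε := hε
  rw [Measure.restrict_restrict measurableSet_Ioi, Ioi_inter_Ioi, sup_eq_left.mpr hε.le]

theorem integrableOn_exp_mul_rpow (h0 : 0 < β) {s ε : ℝ} (hs : 0 ≤ s) (hε : 0 < ε) :
    IntegrableOn (fun l : ℝ => Real.exp (-(l * s)) * l ^ (-1 - β)) (Ioi ε) := by
  refine (integrableOn_Ioi_rpow_of_lt (a := -1 - β) (by linarith) hε).mono'
    (by fun_prop) ?_
  filter_upwards [ae_restrict_mem measurableSet_Ioi] with l hl
  have hl0 : 0 < l := lt_trans hε hl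
  rw [norm_mul, Real.norm_of_nonneg (Real.exp_pos _).le,
    Real.norm_of_nonneg (Real.rpow_nonneg hl0.le _)]
  refine mul_le_of_le_one_left (Real.rpow_nonneg hl0.le _) (Real.exp_le_one_iff.mpr ?_)
  have := mul_nonneg hl0.le hs
  linarith

/-- The part of `e^{-t|∇|^{2β}}` generated by the jumps longer than `ε`. -/
theorem multiplierBound_truncated {d : ℕ} (q : ℝ≥0∞) [Fact (1 ≤ q)] (h0 : 0 < β)
    {l₀ ε : ℝ} (hε : 0 < ε) (hl : ε ≤ l₀)
    (hgap : ∀ l, l₀ ≤ l → MultiplierBound (trigLp (d := d) q) (1 / 2)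
        (fun n => (Real.exp (-(l * laplaceSymbol n.1)) : ℂ))) {t : ℝ} (ht : 0 ≤ t) :
    MultiplierBound (trigLp (d := d) q)
      (Real.exp (-(t * (1 / 2 * ∫ l in Ioi l₀, l ^ (-1 - β)))))
      (fun n => (Real.exp (-(t * ∫ l in Ioi ε,
        (1 - Real.exp (-(l * laplaceSymbol n.1))) * l ^ (-1 - β))) : ℂ)) := by
  have hw : IntegrableOn (fun l : ℝ => l ^ (-1 - β)) (Ioi ε) :=
    integrableOn_Ioi_rpow_of_lt (by linarith) hε
  have hsub : Ioi l₀ ⊆ Ioi ε := Ioi_subset_Ioi hl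
  -- `K` is the weight times the norm bound of the heat operator at time `l`: `1` up to `l₀`, and `1
  -- / 2` beyond.
  set K : ℝ → ℝ := fun l => l ^ (-1 - β) - 1 / 2 * (Ioi l₀).indicator (fun l => l ^ (-1 - β)) l
    with hKdef
  have hind : IntegrableOn ((Ioi l₀).indicator (fun l : ℝ => l ^ (-1 - β))) (Ioi ε) :=
    hw.indicator measurableSet_Ioi
  have hK : IntegrableOn K (Ioi ε) := hw.sub (hind.const_mul _)
  have hKint : ∫ l in Ioi ε, K l =
      (∫ l in Ioi ε, l ^ (-1 - β)) - 1 / 2 * ∫ l in Ioi l₀, l ^ (-1 - β) := by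
    rw [integral_sub hw (hind.const_mul _), integral_const_mul,
      setIntegral_indicator measurableSet_Ioi, inter_eq_right.mpr hsub]
  have hKpos : ∀ l ∈ Ioi ε, 0 ≤ K l := by
    intro l hl'
    have : 0 ≤ l ^ (-1 - β) := Real.rpow_nonneg (hε.trans hl').le _
    by_cases h : l ∈ Ioi l₀
    · simp only [hKdef, indicator_of_mem h]; linarith
    · simp only [hKdef, indicator_of_notMem h]; linarith
  have h2 : MultiplierBound (trigLp (d := d) q) (∫ l in Ioi ε, K l)
      (fun n => ∫ l in Ioi ε, ((Real.exp (-(l * laplaceSymbol n.1)) * l ^ (-1 - β) : ℝ) : ℂ)) := by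
    refine MultiplierBound.integral hK (fun n =>
      (integrableOn_exp_mul_rpow h0 (laplaceSymbol_nonneg n.1) hε).ofReal) ?_
    filter_upwards [ae_restrict_mem measurableSet_Ioi] with l hl'
    have hl0 : 0 < l := hε.trans hl'
    have hlw : 0 ≤ l ^ (-1 - β) := Real.rpow_nonneg hl0.le _
    have key : ∀ κ : ℝ, MultiplierBound (trigLp (d := d) q) κ
        (fun n => (Real.exp (-(l * laplaceSymbol n.1)) : ℂ)) →
        MultiplierBound (trigLp (d := d) q) (l ^ (-1 - β) * κ)
          (fun n => ((Real.exp (-(l * laplaceSymbol n.1)) * l ^ (-1 - β) : ℝ) : ℂ)) := by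
      intro κ hκ
      have := hκ.const_smul ((l ^ (-1 - β) : ℝ) : ℂ)
      rw [Complex.norm_real, Real.norm_of_nonneg hlw] at this
      convert this using 1
      funext n
      rw [Pi.smul_apply, smul_eq_mul, Complex.ofReal_mul, mul_comm]
    by_cases h : l ∈ Ioi l₀
    · refine (key _ (hgap l (le_of_lt h))).mono (le_of_eq ?_)
      simp only [hKdef, indicator_of_mem h]; ring
    · refine (key _ (multiplierBound_heat q hl0.le)).mono (le_of_eq ?_)
      simp only [hKdef, indicator_of_notMem h]; ring
  -- The scalar `e^{-t∫w}`, for the weight `w`, accounts for the `1` in `1 - e^{-ls}`. Against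
  -- `e^{t∫K}` it leaves the gain `e^{-(t/2)∫_{l>l₀} w}`.
  have h3 := (h2.exp ht (setIntegral_nonneg measurableSet_Ioi hKpos)).const_smul
    (Real.exp (-(t * ∫ l in Ioi ε, l ^ (-1 - β))) : ℂ)
  rw [Complex.norm_real, Real.norm_of_nonneg (Real.exp_pos _).le, ← Real.exp_add, hKint] at h3
  convert h3 using 1
  · congr 1
    ring
  · funext n
    have h4 : ∫ l in Ioi ε, (1 - Real.exp (-(l * laplaceSymbol n.1))) * l ^ (-1 - β) =
        (∫ l in Ioi ε, l ^ (-1 - β)) -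
          ∫ l in Ioi ε, Real.exp (-(l * laplaceSymbol n.1)) * l ^ (-1 - β) := by
      rw [← integral_sub hw (integrableOn_exp_mul_rpow h0 (laplaceSymbol_nonneg n.1) hε)]
      exact integral_congr_ae (Eventually.of_forall fun l => by simp only [sub_mul, one_mul])
    rw [h4, Pi.smul_apply, smul_eq_mul, integral_complex_ofReal, ← Complex.ofReal_mul, ← Complex.ofReal_exp,
      ← Complex.ofReal_mul, ← Real.exp_add]
    congr 2
    ring

/-- The gain in `multiplierBound_truncated` comes from `l > l₀` only, so it does not depend on `ε`
and survives the limit `ε → 0`. -/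
theorem exists_multiplierBound_fracHeat (d : ℕ) (h0 : 0 < β) (h1 : β < 1) :
    ∃ c : ℝ, 0 < c ∧ ∀ (q : ℝ≥0∞) [Fact (1 ≤ q)] (t : ℝ), 0 ≤ t →
      MultiplierBound (trigLp (d := d) q) (Real.exp (-(c * t)))
        (fun n => (Real.exp (-(t * laplaceSymbol n.1 ^ β)) : ℂ)) := by
  obtain ⟨l₀, hl₀, hgap⟩ := exists_multiplierBound_heat_half d
  have hC := subordinationConst_pos h0 h1
  have hδ : 0 < ∫ l in Ioi l₀, l ^ (-1 - β) := by
    rw [integral_Ioi_rpow_of_lt (by linarith) hl₀]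
    have h2 : 0 < l₀ ^ (-1 - β + 1) := Real.rpow_pos_of_pos hl₀ _
    exact div_pos_of_neg_of_neg (by linarith) (by linarith)
  refine ⟨(subordinationConst β)⁻¹ * (1 / 2 * ∫ l in Ioi l₀, l ^ (-1 - β)), by positivity,
    fun q _ t ht => ?_⟩
  have ht' : 0 ≤ (subordinationConst β)⁻¹ * t := by positivity
  refine MultiplierBound.of_tendsto (l := 𝓝[>] (0 : ℝ))
    (K := fun _ => Real.exp (-(((subordinationConst β)⁻¹ * t) *
      (1 / 2 * ∫ l in Ioi l₀, l ^ (-1 - β)))))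
    (M := fun ε n => (Real.exp (-(((subordinationConst β)⁻¹ * t) * ∫ l in Ioi ε,
        (1 - Real.exp (-(l * laplaceSymbol n.1))) * l ^ (-1 - β))) : ℂ)) ?_ (fun n => ?_) ?_
  · convert tendsto_const_nhds using 3
    ring
  · have hs : 0 < laplaceSymbol n.1 :=
      lt_of_lt_of_le (by positivity) (four_pi_sq_le_laplaceSymbol n.2)
    have h2 := (tendsto_integral_one_sub_exp_mul_rpow h0 h1 hs).const_mul
      ((subordinationConst β)⁻¹ * t)
    have h3 : (subordinationConst β)⁻¹ * t * (subordinationConst β * laplaceSymbol n.1 ^ β) =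
        t * laplaceSymbol n.1 ^ β := by
      field_simp
    rw [h3] at h2
    exact (Complex.continuous_ofReal.tendsto _).comp ((Real.continuous_exp.tendsto _).comp h2.neg)
  · filter_upwards [Ioc_mem_nhdsGT hl₀] with ε hε
    exact multiplierBound_truncated q h0 hε.1 hε.2 (fun l hl => hgap q l hl) ht'

end Subordination

/-! ### Two-point inequalities of Stroock–Varopoulos type -/

section TwoPoint

open Filter Topology Set

/-- This is Cauchy–Schwarz for `∫_y^x s^{q/2-1} ds`, in discriminant form: the quadratic in `T` is
`∫_y^x (T s^{q/2-1} - 1)² ds ≥ 0`. -/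
theorem rpow_sub_sq_le_of_le {q x y : ℝ} (hq : 1 < q) (hy : 0 < y) (hyx : y ≤ x) :
    4 * (q - 1) / q ^ 2 * (x ^ (q / 2) - y ^ (q / 2)) ^ 2 ≤
      (x - y) * (x ^ (q - 1) - y ^ (q - 1)) := by
  have hq1 : 0 < q - 1 := by linarith
  have key : ∀ T : ℝ, 0 ≤ (x ^ (q - 1) - y ^ (q - 1)) / (q - 1) * (T * T) +
      (-(4 / q * (x ^ (q / 2) - y ^ (q / 2)))) * T + (x - y) := by
    intro T
    -- An antiderivative of `(T s^{q/2-1} - 1)²`, so that monotonicity replaces integration.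
    let g : ℝ → ℝ := fun s => s ^ (q - 1) / (q - 1) * (T * T) - 4 / q * s ^ (q / 2) * T + s
    have hd : ∀ s ∈ Ioi (0 : ℝ), HasDerivAt g ((T * s ^ (q / 2 - 1) - 1) ^ 2) s := by
      intro s hs
      have hs : 0 < s := hs
      have h1 := (((Real.hasDerivAt_rpow_const (p := q - 1) (Or.inl hs.ne')).div_const
        (q - 1)).mul_const (T * T)).sub
        (((Real.hasDerivAt_rpow_const (p := q / 2) (Or.inl hs.ne')).const_mul (4 / q)).mul_const T)
      refine (h1.add (hasDerivAt_id s)).congr_deriv ?_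
      have h2 : s ^ (q - 1 - 1) = s ^ (q / 2 - 1) * s ^ (q / 2 - 1) := by
        rw [← Real.rpow_add hs]; congr 1; ring
      rw [h2]
      field_simp
      ring
    have hmono : MonotoneOn g (Ioi 0) :=
      monotoneOn_of_deriv_nonneg (convex_Ioi 0)
        (fun s hs => (hd s hs).continuousAt.continuousWithinAt)
        (fun s hs => (hd s (interior_subset hs)).differentiableAt.differentiableWithinAt)
        (fun s hs => by rw [(hd s (interior_subset hs)).deriv]; exact sq_nonneg _)
    have h3 : g y ≤ g x := hmono hy (hy.trans_le hyx) hyx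
    have h4 : (x ^ (q - 1) - y ^ (q - 1)) / (q - 1) * (T * T) +
      (-(4 / q * (x ^ (q / 2) - y ^ (q / 2)))) * T + (x - y) = g x - g y := by
      simp only [g]; ring
    rw [h4]
    linarith
  have h5 := discrim_le_zero key
  rw [discrim] at h5
  have h6 : 4 * (q - 1) / q ^ 2 * (x ^ (q / 2) - y ^ (q / 2)) ^ 2 =
      (q - 1) / 4 * (-(4 / q * (x ^ (q / 2) - y ^ (q / 2)))) ^ 2 := by
    field_simp
  have h7 : (x - y) * (x ^ (q - 1) - y ^ (q - 1)) =
      (q - 1) / 4 * (4 * ((x ^ (q - 1) - y ^ (q - 1)) / (q - 1)) * (x - y)) := by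
    field_simp
  rw [h6, h7]
  exact mul_le_mul_of_nonneg_left (by linarith) (by positivity)

theorem rpow_sub_sq_le {q x y : ℝ} (hq : 1 < q) (hx : 0 < x) (hy : 0 < y) :
    4 * (q - 1) / q ^ 2 * (x ^ (q / 2) - y ^ (q / 2)) ^ 2 ≤
      (x - y) * (x ^ (q - 1) - y ^ (q - 1)) := by
  rcases le_total y x with h | h
  · exact rpow_sub_sq_le_of_le hq hy h
  · have := rpow_sub_sq_le_of_le hq hx h
    nlinarith

theorem four_mul_sub_one_div_sq_le_one {q : ℝ} (hq : 1 < q) : 4 * (q - 1) / q ^ 2 ≤ 1 := by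
  rw [div_le_one (by positivity)]
  nlinarith [sq_nonneg (q - 2)]

variable {H : Type*} [NormedAddCommGroup H] [InnerProductSpace ℝ H]

/-- The map `z ↦ |z|^(p-1) z`. -/
noncomputable def powMap (p : ℝ) (z : H) : H := ‖z‖ ^ (p - 1) • z

theorem powMap_zero (p : ℝ) : powMap p (0 : H) = 0 := smul_zero _

theorem norm_powMap {p : ℝ} (hp : 0 < p) (z : H) : ‖powMap p z‖ = ‖z‖ ^ p := by
  rcases eq_or_ne z 0 with rfl | hz
  · rw [powMap_zero, norm_zero, Real.zero_rpow hp.ne']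
  · have hz' : 0 < ‖z‖ := norm_pos_iff.mpr hz
    rw [powMap, norm_smul, Real.norm_of_nonneg (Real.rpow_nonneg hz'.le _)]
    nth_rewrite 2 [← Real.rpow_one ‖z‖]
    rw [← Real.rpow_add hz', sub_add_cancel]

theorem continuous_powMap {p : ℝ} (hp : 0 < p) : Continuous (powMap p : H → H) := by
  refine continuous_iff_continuousAt.mpr fun z => ?_
  rcases eq_or_ne z 0 with rfl | hz
  · rw [ContinuousAt, powMap_zero, tendsto_zero_iff_norm_tendsto_zero]
    simp only [norm_powMap hp]
    have := ((continuous_norm (E := H)).rpow_const fun _ => Or.inr hp.le).tendsto 0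
    simpa [Real.zero_rpow hp.ne'] using this
  · exact (continuous_norm.continuousAt.rpow_const (Or.inl (norm_ne_zero_iff.mpr hz))).smul
      continuousAt_id

theorem inner_powMap_self {q : ℝ} (hq : 1 < q) (z : H) :
    inner ℝ z (powMap (q - 1) z) = ‖z‖ ^ q := by
  rcases eq_or_ne z 0 with rfl | hz
  · rw [inner_zero_left, norm_zero, Real.zero_rpow (by linarith)]
  · have hz' : 0 < ‖z‖ := norm_pos_iff.mpr hz
    rw [powMap, real_inner_smul_right, real_inner_self_eq_norm_sq, ← Real.rpow_natCast,
      ← Real.rpow_add hz']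
    congr 1
    push_cast
    ring

theorem norm_powMap_half_sq {q : ℝ} (hq : 1 < q) (z : H) :
    ‖powMap (q / 2) z‖ ^ 2 = ‖z‖ ^ q := by
  rw [norm_powMap (by linarith), ← Real.rpow_mul_natCast (norm_nonneg z)]
  congr 1
  push_cast
  ring

/-- The Dirichlet-type expressions of two nonzero vectors in terms of their lengths and the cosine
`c` of the angle between them. -/
theorem exists_two_point_expansion {q : ℝ} (hq : 1 < q) {a b : H} (ha : a ≠ 0) (hb : b ≠ 0) :
    ∃ c : ℝ, -1 ≤ c ∧ c ≤ 1 ∧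
      inner ℝ (a - b) (powMap (q - 1) a - powMap (q - 1) b) = ‖a‖ ^ q + ‖b‖ ^ q -
        c * (‖a‖ * ‖b‖ ^ (q - 1) + ‖a‖ ^ (q - 1) * ‖b‖) ∧
      ‖powMap (q / 2) a - powMap (q / 2) b‖ ^ 2 =
        ‖a‖ ^ q + ‖b‖ ^ q - 2 * c * (‖a‖ ^ (q / 2) * ‖b‖ ^ (q / 2)) := by
  have hx : 0 < ‖a‖ := norm_pos_iff.mpr ha
  have hy : 0 < ‖b‖ := norm_pos_iff.mpr hb
  have hpow : ∀ p z : ℝ, 0 < z → z ^ p = z ^ (p - 1) * z := fun p z hz => by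
    nth_rewrite 3 [← Real.rpow_one z]
    rw [← Real.rpow_add hz, sub_add_cancel]
  obtain ⟨hc1, hc2⟩ := abs_le.mp (abs_real_inner_div_norm_mul_norm_le_one a b)
  have hR : inner ℝ a b = inner ℝ a b / (‖a‖ * ‖b‖) * (‖a‖ * ‖b‖) := by field_simp
  refine ⟨_, hc1, hc2, ?_, ?_⟩
  · rw [inner_sub_left, inner_sub_right, inner_sub_right, inner_powMap_self hq,
      inner_powMap_self hq, powMap, powMap, real_inner_smul_right, real_inner_smul_right,
      real_inner_comm a b, hpow (q - 1) _ hx, hpow (q - 1) _ hy]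
    linear_combination (-(‖a‖ ^ (q - 1 - 1)) - ‖b‖ ^ (q - 1 - 1)) * hR
  · rw [norm_sub_sq_real, norm_powMap_half_sq hq, norm_powMap_half_sq hq, powMap, powMap,
      real_inner_smul_right, real_inner_smul_left, hpow (q / 2) _ hx, hpow (q / 2) _ hy]
    linear_combination (-2 * ‖a‖ ^ (q / 2 - 1) * ‖b‖ ^ (q / 2 - 1)) * hR

/-- AM–GM: the two terms on the right have product `x^q y^q`. -/
theorem two_mul_geom_le {q x y : ℝ} (hx : 0 < x) (hy : 0 < y) :
    2 * (x ^ (q / 2) * y ^ (q / 2)) ≤ x * y ^ (q - 1) + x ^ (q - 1) * y := by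
  have h1 : (x ^ (q / 2) * y ^ (q / 2)) ^ 2 = (x * y ^ (q - 1)) * (x ^ (q - 1) * y) := by
    have hs : ∀ z : ℝ, 0 < z → (z ^ (q / 2)) ^ 2 = z ^ (q - 1) * z := fun z hz => by
      rw [← Real.rpow_mul_natCast hz.le]
      nth_rewrite 3 [← Real.rpow_one z]
      rw [← Real.rpow_add hz]
      congr 1; push_cast; ring
    rw [mul_pow, hs x hx, hs y hy]; ring
  have hA : 0 ≤ x * y ^ (q - 1) := by positivity
  have hB : 0 ≤ x ^ (q - 1) * y := by positivity
  refine (pow_le_pow_iff_left₀ (by positivity) (add_nonneg hA hB) two_ne_zero).mp ?_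
  nlinarith [sq_nonneg (x * y ^ (q - 1) - x ^ (q - 1) * y)]

theorem mixed_eq_add_rpow_sub {q x y : ℝ} (hx : 0 < x) (hy : 0 < y) :
    x * y ^ (q - 1) + x ^ (q - 1) * y = x ^ q + y ^ q - (x - y) * (x ^ (q - 1) - y ^ (q - 1)) := by
  have hpow : ∀ z : ℝ, 0 < z → z ^ q = z ^ (q - 1) * z := fun z hz => by
    nth_rewrite 3 [← Real.rpow_one z]
    rw [← Real.rpow_add hz, sub_add_cancel]
  rw [hpow x hx, hpow y hy]; ring

/-- The Stroock–Varopoulos inequality for vectors. -/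
theorem norm_powMap_half_sub_sq_le_inner {q : ℝ} (hq : 1 < q) (a b : H) :
    4 * (q - 1) / q ^ 2 * ‖powMap (q / 2) a - powMap (q / 2) b‖ ^ 2 ≤
      inner ℝ (a - b) (powMap (q - 1) a - powMap (q - 1) b) := by
  have hk := four_mul_sub_one_div_sq_le_one hq
  rcases eq_or_ne a 0 with rfl | ha
  · rw [powMap_zero, powMap_zero, zero_sub, zero_sub, zero_sub, norm_neg, inner_neg_neg,
      norm_powMap_half_sq hq, inner_powMap_self hq]
    exact mul_le_of_le_one_left (by positivity) hk
  rcases eq_or_ne b 0 with rfl | hb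
  · rw [powMap_zero, powMap_zero, sub_zero, sub_zero, sub_zero,
      norm_powMap_half_sq hq, inner_powMap_self hq]
    exact mul_le_of_le_one_left (by positivity) hk
  have hx : 0 < ‖a‖ := norm_pos_iff.mpr ha
  have hy : 0 < ‖b‖ := norm_pos_iff.mpr hb
  obtain ⟨c, -, hc, h1, h2⟩ := exists_two_point_expansion hq ha hb
  have hG := two_mul_geom_le (q := q) hx hy
  have hM := mixed_eq_add_rpow_sub (q := q) hx hy
  have hS := rpow_sub_sq_le hq hx hy
  have hsq : ∀ z : ℝ, 0 < z → z ^ q = z ^ (q / 2) * z ^ (q / 2) := fun z hz => by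
    rw [← Real.rpow_add hz, add_halves]
  have hG0 : 0 ≤ ‖a‖ ^ (q / 2) * ‖b‖ ^ (q / 2) := by positivity
  rw [h1, h2]
  set k := 4 * (q - 1) / q ^ 2
  set G := ‖a‖ ^ (q / 2) * ‖b‖ ^ (q / 2) with hGdef
  set A := ‖a‖ * ‖b‖ ^ (q - 1) + ‖a‖ ^ (q - 1) * ‖b‖
  have hS' : k * (‖a‖ ^ q + ‖b‖ ^ q - 2 * G) ≤ ‖a‖ ^ q + ‖b‖ ^ q - A := by
    have : ‖a‖ ^ q + ‖b‖ ^ q - 2 * G = (‖a‖ ^ (q / 2) - ‖b‖ ^ (q / 2)) ^ 2 := by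
      rw [hsq _ hx, hsq _ hy, hGdef]; ring
    rw [this]; linarith
  -- The difference of the two sides is affine in the cosine `c` with slope `2kG - A ≤ 0`, so the
  -- worst case is `c = 1`, the scalar inequality `hS'`.
  have h3 : 2 * k * G ≤ A := by nlinarith
  nlinarith [mul_nonneg (sub_nonneg.mpr hc) (sub_nonneg.mpr h3)]

/-- With `N = |a|^q + |b|^q`, `A` the mixed term and `G` the geometric mean, the difference of the
sides is `N - 4cG + cA`. It is affine in `c` and nonnegative at `c = ±1` because `2G ≤ A ≤ N`. The
constant does not depend on `q`. -/
theorem inner_le_two_mul_norm_powMap_half_sub_sq {q : ℝ} (hq : 1 < q) (a b : H) :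
    inner ℝ (a - b) (powMap (q - 1) a - powMap (q - 1) b) ≤
      2 * ‖powMap (q / 2) a - powMap (q / 2) b‖ ^ 2 := by
  rcases eq_or_ne a 0 with rfl | ha
  · rw [powMap_zero, powMap_zero, zero_sub, zero_sub, zero_sub, norm_neg, inner_neg_neg,
      norm_powMap_half_sq hq, inner_powMap_self hq]
    linarith [Real.rpow_nonneg (norm_nonneg b) q]
  rcases eq_or_ne b 0 with rfl | hb
  · rw [powMap_zero, powMap_zero, sub_zero, sub_zero, sub_zero,
      norm_powMap_half_sq hq, inner_powMap_self hq]
    linarith [Real.rpow_nonneg (norm_nonneg a) q]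
  have hx : 0 < ‖a‖ := norm_pos_iff.mpr ha
  have hy : 0 < ‖b‖ := norm_pos_iff.mpr hb
  obtain ⟨c, hc', hc, h1, h2⟩ := exists_two_point_expansion hq ha hb
  have hG := two_mul_geom_le (q := q) hx hy
  have hM := mixed_eq_add_rpow_sub (q := q) hx hy
  have hS := rpow_sub_sq_le hq hx hy
  have hS0 : 0 ≤ 4 * (q - 1) / q ^ 2 * (‖a‖ ^ (q / 2) - ‖b‖ ^ (q / 2)) ^ 2 := by
    have : 0 < q - 1 := by linarith
    positivity
  have hG0 : 0 ≤ ‖a‖ ^ (q / 2) * ‖b‖ ^ (q / 2) := by positivity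
  rw [h1, h2]
  nlinarith

end TwoPoint

/-! ### Variance, summation by parts and discrete Dirichlet energy -/

section Dissipation

open Filter Topology UnitAddTorus

variable {d : ℕ}

theorem integrable_of_continuous {E : Type*} [NormedAddCommGroup E]
    {f : UnitAddTorus (Fin d) → E} (hf : Continuous f) : Integrable f (torusMeasure d) :=
  hf.integrable_of_hasCompactSupport (HasCompactSupport.of_compactSpace f)

/-- For mean zero `u`, the variance of `|u|^(q/2-1) u` is at least half its second moment. -/
theorem integral_rpow_le_two_mul_variance {q : ℝ} (hq : 1 < q) {u : UnitAddTorus (Fin d) → ℂ}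
    (hu : Continuous u) (hmean : ∫ x, u x ∂torusMeasure d = 0) :
    ∫ x, ‖u x‖ ^ q ∂torusMeasure d ≤
      2 * (∫ x, ‖u x‖ ^ q ∂torusMeasure d -
        ‖∫ x, powMap (q / 2) (u x) ∂torusMeasure d‖ ^ 2) := by
  have hJ : Continuous fun x => powMap (q - 1) (u x) :=
    (continuous_powMap (by linarith)).comp hu
  have hV : Continuous fun x => powMap (q / 2) (u x) :=
    (continuous_powMap (by linarith)).comp hu
  have hN : Continuous fun x => ‖u x‖ ^ q :=
    hu.norm.rpow_const fun _ => Or.inr (by linarith)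
  set P := ∫ x, ‖u x‖ ^ q ∂torusMeasure d with hP
  set M := ∫ x, powMap (q / 2) (u x) ∂torusMeasure d with hM
  set W := ∫ x, powMap (q - 1) (u x) ∂torusMeasure d with hW
  -- The upper two-point inequality at `u x`, `u y`, expanded for integration over both variables.
  -- The cross terms on the left integrate to zero since `u` has mean zero; those on the right give
  -- `‖M‖ ^ 2`.
  have h1 : ∀ x y, ‖u x‖ ^ q + ‖u y‖ ^ q - inner ℝ (u x) (powMap (q - 1) (u y)) -
      inner ℝ (powMap (q - 1) (u x)) (u y) ≤
      2 * (‖u x‖ ^ q + ‖u y‖ ^ q) -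
        4 * inner ℝ (powMap (q / 2) (u x)) (powMap (q / 2) (u y)) := by
    intro x y
    have h := inner_le_two_mul_norm_powMap_half_sub_sq hq (u x) (u y)
    rw [norm_sub_sq_real, norm_powMap_half_sq hq, norm_powMap_half_sq hq, inner_sub_left,
      inner_sub_right, inner_sub_right, inner_powMap_self hq, inner_powMap_self hq,
      real_inner_comm (powMap (q - 1) (u x)) (u y)] at h
    linarith
  have h2 : ∀ x, ‖u x‖ ^ q + P - inner ℝ W (u x) ≤
      2 * (‖u x‖ ^ q + P) - 4 * inner ℝ M (powMap (q / 2) (u x)) := by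
    intro x
    have h := integral_mono (μ := torusMeasure d)
      (integrable_of_continuous (by fun_prop)) (integrable_of_continuous (by fun_prop)) (h1 x)
    have e1 : ∫ y, inner ℝ (u x) (powMap (q - 1) (u y)) ∂torusMeasure d = inner ℝ W (u x) := by
      rw [real_inner_comm]
      exact integral_inner (integrable_of_continuous hJ) _
    have e2 : ∫ y, inner ℝ (powMap (q - 1) (u x)) (u y) ∂torusMeasure d = 0 := by
      rw [integral_inner (integrable_of_continuous hu), hmean, inner_zero_right]
    have e3 : ∫ y, inner ℝ (powMap (q / 2) (u x)) (powMap (q / 2) (u y)) ∂torusMeasure d =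
        inner ℝ M (powMap (q / 2) (u x)) := by
      rw [real_inner_comm]
      exact integral_inner (integrable_of_continuous hV) _
    rw [integral_sub, integral_sub, integral_add, integral_sub, integral_const_mul, integral_add,
      integral_const_mul, e1, e2, e3] at h
    · simpa using h
    all_goals exact integrable_of_continuous (by fun_prop)
  have h := integral_mono (μ := torusMeasure d)
      (integrable_of_continuous (by fun_prop)) (integrable_of_continuous (by fun_prop)) h2
  have e1 : ∫ x, inner ℝ W (u x) ∂torusMeasure d = 0 := by
    rw [integral_inner (integrable_of_continuous hu), hmean, inner_zero_right]
  have e3 : ∫ x, inner ℝ M (powMap (q / 2) (u x)) ∂torusMeasure d = ‖M‖ ^ 2 := by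
    rw [integral_inner (integrable_of_continuous hV), real_inner_self_eq_norm_sq]
  rw [integral_sub, integral_add, integral_sub, integral_const_mul, integral_add,
    integral_const_mul, e1, e3] at h
  · simp only [integral_const, probReal_univ, one_smul] at h
    linarith
  all_goals exact integrable_of_continuous (by fun_prop)

/-- Summation by parts for the second difference. -/
theorem integral_inner_second_difference {u w : UnitAddTorus (Fin d) → ℂ} (hu : Continuous u)
    (hw : Continuous w) (y : UnitAddTorus (Fin d)) :
    ∫ x, inner ℝ (2 * u x - u (x + y) - u (x - y)) (w x) ∂torusMeasure d =
      ∫ x, inner ℝ (u (x + y) - u x) (w (x + y) - w x) ∂torusMeasure d := by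
  have h1 : ∫ x, inner ℝ (u (x + y)) (w (x + y)) ∂torusMeasure d =
      ∫ x, inner ℝ (u x) (w x) ∂torusMeasure d :=
    integral_add_right_eq_self (fun x => inner ℝ (u x) (w x)) y
  have h2 : ∫ x, inner ℝ (u x) (w (x + y)) ∂torusMeasure d =
      ∫ x, inner ℝ (u (x - y)) (w x) ∂torusMeasure d := by
    rw [← integral_add_right_eq_self (fun x => inner ℝ (u (x - y)) (w x)) y]
    simp only [add_sub_cancel_right]
  simp only [inner_sub_left, inner_sub_right, two_mul, inner_add_left]
  rw [integral_sub, integral_sub, integral_add, integral_sub, integral_sub, integral_sub]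
  · linarith
  all_goals exact integrable_of_continuous (by fun_prop)

theorem hasSum_sq_mFourierCoeff_of_continuous (v : C(UnitAddTorus (Fin d), ℂ)) :
    HasSum (fun n => ‖mFourierCoeff v n‖ ^ 2) (∫ x, ‖v x‖ ^ 2 ∂torusMeasure d) := by
  have h : HasSum
      (fun n => ‖mFourierCoeff (ContinuousMap.toLp 2 (torusMeasure d) ℂ v) n‖ ^ 2)
      (∫ x, ‖ContinuousMap.toLp 2 (torusMeasure d) ℂ v x‖ ^ 2 ∂torusMeasure d) :=
    hasSum_sq_mFourierCoeff (ContinuousMap.toLp 2 (torusMeasure d) ℂ v)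
  have h1 : ∀ n, mFourierCoeff (ContinuousMap.toLp 2 (torusMeasure d) ℂ v) n =
      mFourierCoeff v n := fun n => mFourierCoeff_congr_ae (ContinuousMap.coeFn_toLp _ _) n
  have h2 : ∫ x, ‖ContinuousMap.toLp 2 (torusMeasure d) ℂ v x‖ ^ 2 ∂torusMeasure d =
      ∫ x, ‖v x‖ ^ 2 ∂torusMeasure d := by
    refine integral_congr_ae ?_
    filter_upwards [ContinuousMap.coeFn_toLp (p := 2) (𝕜 := ℂ) (torusMeasure d) v] with x hx
    rw [hx]
  simpa only [h1, h2] using h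

theorem mFourierCoeff_comp_add (v : C(UnitAddTorus (Fin d), ℂ)) (y : UnitAddTorus (Fin d))
    (n : Fin d → ℤ) :
    mFourierCoeff (fun x => v (x + y)) n = mFourier n y * mFourierCoeff v n := by
  have h := integral_add_right_eq_self (μ := torusMeasure d) (fun x => mFourier (-n) x • v x) y
  have h1 : mFourierCoeff v n = ∫ x, mFourier (-n) (x + y) • v (x + y) ∂torusMeasure d := h.symm
  rw [h1, ← integral_const_mul]
  refine integral_congr_ae (Eventually.of_forall fun x => ?_)
  simp only [smul_eq_mul, mFourier_apply_add]
  have h2 : mFourier n y * mFourier (-n) y = 1 := by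
    rw [← mFourier_add, add_neg_cancel, mFourier_zero]; rfl
  linear_combination (-(mFourier (-n) x * v (x + y))) * h2

theorem mFourierCoeff_translate_sub (v : C(UnitAddTorus (Fin d), ℂ)) (y : UnitAddTorus (Fin d))
    (n : Fin d → ℤ) :
    mFourierCoeff (fun x => v (x + y) - v x) n = (mFourier n y - 1) * mFourierCoeff v n := by
  rw [sub_mul, one_mul, ← mFourierCoeff_comp_add]
  have h := integral_sub (μ := torusMeasure d)
    (integrable_mFourier_mul (integrable_of_continuous (f := fun x => v (x + y)) (by fun_prop)) (-n))
    (integrable_mFourier_mul (integrable_of_continuous v.continuous) (-n))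
  refine Eq.trans ?_ h
  refine integral_congr_ae (Eventually.of_forall fun x => ?_)
  simp only [smul_eq_mul, mul_sub]

theorem norm_mFourier_axisPoint_sub_one_sq (n : Fin d → ℤ) (j : Fin d) (h : ℝ) :
    ‖mFourier n (axisPoint j h) - 1‖ ^ 2 = 2 * (1 - Real.cos (2 * Real.pi * n j * h)) := by
  rw [mFourier_axisPoint, ← Complex.normSq_eq_norm_sq, Complex.normSq_apply]
  simp only [Complex.sub_re, Complex.sub_im, Complex.exp_ofReal_mul_I_re,
    Complex.exp_ofReal_mul_I_im, Complex.one_re, Complex.one_im]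
  nlinarith [Real.sin_sq_add_cos_sq (2 * Real.pi * n j * h)]

/-- A discrete form of Bessel's inequality for the Dirichlet energy. -/
theorem sum_diffSymbol_mul_le (v : C(UnitAddTorus (Fin d), ℂ)) (S : Finset (Fin d → ℤ)) (h : ℝ) :
    ∑ n ∈ S, diffSymbol h n * ‖mFourierCoeff v n‖ ^ 2 ≤
      ∑ j, (∫ x, ‖v (x + axisPoint j h) - v x‖ ^ 2 ∂torusMeasure d) / h ^ 2 := by
  simp only [diffSymbol, Finset.sum_mul]
  rw [Finset.sum_comm]
  refine Finset.sum_le_sum fun j _ => ?_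
  let g : C(UnitAddTorus (Fin d), ℂ) := ⟨fun x => v (x + axisPoint j h) - v x, by fun_prop⟩
  have h1 := sum_le_hasSum S (fun n _ => sq_nonneg _) (hasSum_sq_mFourierCoeff_of_continuous g)
  have h2 : ∀ n, ‖mFourierCoeff g n‖ ^ 2 =
      2 * (1 - Real.cos (2 * Real.pi * n j * h)) * ‖mFourierCoeff v n‖ ^ 2 := fun n => by
    have := mFourierCoeff_translate_sub v (axisPoint j h) n
    change ‖mFourierCoeff (fun x => v (x + axisPoint j h) - v x) n‖ ^ 2 = _
    rw [this, norm_mul, mul_pow, norm_mFourier_axisPoint_sub_one_sq]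
  simp only [h2] at h1
  have h3 := div_le_div_of_nonneg_right h1 (sq_nonneg h)
  rw [Finset.sum_div] at h3
  refine le_of_eq_of_le (Finset.sum_congr rfl fun n _ => ?_) h3
  ring

/-- The trigonometric polynomial with coefficients `c` on `S`. -/
noncomputable def trigPoly (S : Finset {n : Fin d → ℤ // n ≠ 0}) (c : {n : Fin d → ℤ // n ≠ 0} → ℂ) :
    C(UnitAddTorus (Fin d), ℂ) := ∑ n ∈ S, c n • mFourier n.1

theorem trigPoly_apply (S : Finset {n : Fin d → ℤ // n ≠ 0}) (c : {n : Fin d → ℤ // n ≠ 0} → ℂ)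
    (x : UnitAddTorus (Fin d)) : trigPoly S c x = ∑ n ∈ S, c n * mFourier n.1 x := by
  simp [trigPoly]

theorem integral_trigPoly (S : Finset {n : Fin d → ℤ // n ≠ 0}) (c : {n : Fin d → ℤ // n ≠ 0} → ℂ) :
    ∫ x, trigPoly S c x ∂torusMeasure d = 0 := by
  simp only [trigPoly_apply]
  rw [integral_finsetSum]
  · refine Finset.sum_eq_zero fun n _ => ?_
    rw [integral_const_mul, integral_mFourier, if_neg n.2, mul_zero]
  · exact fun n _ => integrable_of_continuous (by fun_prop)

theorem second_difference_trigPoly (S : Finset {n : Fin d → ℤ // n ≠ 0})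
    (c : {n : Fin d → ℤ // n ≠ 0} → ℂ) (h : ℝ) (j : Fin d) (x : UnitAddTorus (Fin d)) :
    2 * trigPoly S c x - trigPoly S c (x + axisPoint j h) - trigPoly S c (x - axisPoint j h) =
      trigPoly S (fun n => (2 * (1 - Real.cos (2 * Real.pi * n.1 j * h)) : ℝ) * c n) x := by
  have h1 : -axisPoint j h = axisPoint j (-h) := by
    simp [axisPoint, ← Pi.single_neg]
  simp only [trigPoly_apply, sub_eq_add_neg x, h1, Finset.mul_sum, ← Finset.sum_sub_distrib]
  refine Finset.sum_congr rfl fun n _ => ?_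
  rw [mFourier_apply_add, mFourier_apply_add, mFourier_axisPoint, mFourier_axisPoint]
  push_cast
  rw [Complex.cos]
  simp only [mul_neg]
  ring

end Dissipation

/-! ### Dissipation, resolvent bound and exponential decay -/

section Resolvent

open Filter Topology UnitAddTorus

variable {d : ℕ}

theorem trigPoly_diffSymbol_apply (S : Finset {n : Fin d → ℤ // n ≠ 0})
    (c : {n : Fin d → ℤ // n ≠ 0} → ℂ) (h : ℝ) (x : UnitAddTorus (Fin d)) :
    trigPoly S (fun n => (diffSymbol h n.1 : ℂ) * c n) x =
      ∑ j, (h ^ 2)⁻¹ • (2 * trigPoly S c x - trigPoly S c (x + axisPoint j h) -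
        trigPoly S c (x - axisPoint j h)) := by
  simp only [second_difference_trigPoly]
  simp only [trigPoly_apply, Finset.smul_sum]
  rw [Finset.sum_comm]
  refine Finset.sum_congr rfl fun n _ => ?_
  rw [diffSymbol, Complex.ofReal_sum, Finset.sum_mul, Finset.sum_mul]
  refine Finset.sum_congr rfl fun j _ => ?_
  rw [Complex.real_smul]
  push_cast
  ring

/-- Summation by parts makes the right side a sum of two-point expressions, to which
Stroock–Varopoulos applies pointwise. Finite differences avoid differentiating `v`, which need not
be smooth where `u` vanishes. -/
theorem sum_diffSymbol_mul_le_integral {q : ℝ} (hq : 1 < q)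
    (S : Finset {n : Fin d → ℤ // n ≠ 0}) (c : {n : Fin d → ℤ // n ≠ 0} → ℂ)
    {v : C(UnitAddTorus (Fin d), ℂ)} (hv : ∀ x, v x = powMap (q / 2) (trigPoly S c x))
    (T : Finset (Fin d → ℤ)) (h : ℝ) :
    4 * (q - 1) / q ^ 2 * ∑ n ∈ T, diffSymbol h n * ‖mFourierCoeff v n‖ ^ 2 ≤
      ∫ x, inner ℝ (trigPoly S (fun n => (diffSymbol h n.1 : ℂ) * c n) x)
        (powMap (q - 1) (trigPoly S c x)) ∂torusMeasure d := by
  have hq1 : 0 < q - 1 := by linarith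
  set u := trigPoly S c with hu
  have hJ : Continuous fun x => powMap (q - 1) (u x) := (continuous_powMap hq1).comp u.continuous
  have h1 : ∫ x, inner ℝ (trigPoly S (fun n => (diffSymbol h n.1 : ℂ) * c n) x)
        (powMap (q - 1) (u x)) ∂torusMeasure d =
      ∑ j, (h ^ 2)⁻¹ * ∫ x, inner ℝ (u (x + axisPoint j h) - u x)
        (powMap (q - 1) (u (x + axisPoint j h)) - powMap (q - 1) (u x)) ∂torusMeasure d := by
    simp only [trigPoly_diffSymbol_apply, sum_inner, real_inner_smul_left]
    rw [integral_finsetSum]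
    · refine Finset.sum_congr rfl fun j _ => ?_
      rw [integral_const_mul, integral_inner_second_difference u.continuous hJ]
    · exact fun j _ => integrable_of_continuous (by fun_prop)
  rw [h1]
  refine (mul_le_mul_of_nonneg_left (sum_diffSymbol_mul_le v T h) (by positivity)).trans ?_
  rw [Finset.mul_sum]
  refine Finset.sum_le_sum fun j _ => ?_
  rw [div_eq_inv_mul _ (h ^ 2), mul_left_comm]
  refine mul_le_mul_of_nonneg_left ?_ (by positivity)
  rw [← integral_const_mul]
  have hJ' : Continuous fun x => powMap (q - 1) (u (x + axisPoint j h)) :=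
    hJ.comp (continuous_add_const _)
  refine integral_mono (integrable_of_continuous (by fun_prop))
    (integrable_of_continuous (by fun_prop)) fun x => ?_
  simp only [hv]
  exact norm_powMap_half_sub_sq_le_inner hq _ _

/-- The limit `h → 0`. Both sides are finite sums over frequencies, so only the symbols have to
converge. -/
theorem sum_laplaceSymbol_mul_le_integral {q : ℝ} (hq : 1 < q)
    (S : Finset {n : Fin d → ℤ // n ≠ 0}) (c : {n : Fin d → ℤ // n ≠ 0} → ℂ)
    {v : C(UnitAddTorus (Fin d), ℂ)} (hv : ∀ x, v x = powMap (q / 2) (trigPoly S c x))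
    (T : Finset (Fin d → ℤ)) :
    4 * (q - 1) / q ^ 2 * ∑ n ∈ T, laplaceSymbol n * ‖mFourierCoeff v n‖ ^ 2 ≤
      ∫ x, inner ℝ (trigPoly S (fun n => (laplaceSymbol n.1 : ℂ) * c n) x)
        (powMap (q - 1) (trigPoly S c x)) ∂torusMeasure d := by
  have hJ : Continuous fun x => powMap (q - 1) (trigPoly S c x) :=
    (continuous_powMap (by linarith)).comp (trigPoly S c).continuous
  have key : ∀ s : {n : Fin d → ℤ // n ≠ 0} → ℝ,
      ∫ x, inner ℝ (trigPoly S (fun n => (s n : ℂ) * c n) x)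
        (powMap (q - 1) (trigPoly S c x)) ∂torusMeasure d =
      ∑ n ∈ S, s n * ∫ x, inner ℝ (c n * mFourier n.1 x)
        (powMap (q - 1) (trigPoly S c x)) ∂torusMeasure d := by
    intro s
    have h1 : ∀ x, trigPoly S (fun n => (s n : ℂ) * c n) x =
        ∑ n ∈ S, s n • (c n * mFourier n.1 x) := fun x => by
      simp only [trigPoly_apply, Complex.real_smul, mul_assoc]
    simp only [h1, sum_inner, real_inner_smul_left]
    rw [integral_finsetSum]
    · simp only [integral_const_mul]
    · exact fun n _ => integrable_of_continuous (by fun_prop)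
  rw [key]
  refine le_of_tendsto_of_tendsto (b := 𝓝[≠] (0 : ℝ)) ?_ ?_
    (Eventually.of_forall fun h => (sum_diffSymbol_mul_le_integral hq S c hv T h).trans_eq (key _))
  · exact (tendsto_finsetSum T fun n _ => (tendsto_diffSymbol n).mul_const _).const_mul _
  · exact tendsto_finsetSum S fun n _ => (tendsto_diffSymbol n.1).mul_const _

/-- The `L^q` dissipation of the Laplacian on mean zero trigonometric polynomials. -/
theorem mul_integral_rpow_le_dissipation {q : ℝ} (hq : 1 < q)
    (S : Finset {n : Fin d → ℤ // n ≠ 0}) (c : {n : Fin d → ℤ // n ≠ 0} → ℂ) :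
    8 * Real.pi ^ 2 * ((q - 1) / q ^ 2) * ∫ x, ‖trigPoly S c x‖ ^ q ∂torusMeasure d ≤
      ∫ x, inner ℝ (trigPoly S (fun n => (laplaceSymbol n.1 : ℂ) * c n) x)
        (powMap (q - 1) (trigPoly S c x)) ∂torusMeasure d := by
  have hq1 : 0 < q - 1 := by linarith
  let v : C(UnitAddTorus (Fin d), ℂ) :=
    ⟨fun x => powMap (q / 2) (trigPoly S c x),
      (continuous_powMap (by linarith)).comp (trigPoly S c).continuous⟩
  set R := ∫ x, inner ℝ (trigPoly S (fun n => (laplaceSymbol n.1 : ℂ) * c n) x)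
        (powMap (q - 1) (trigPoly S c x)) ∂torusMeasure d
  have h1 := hasSum_sq_mFourierCoeff_of_continuous v
  have h2 : ∀ x, ‖v x‖ ^ 2 = ‖trigPoly S c x‖ ^ q := fun x => norm_powMap_half_sq hq _
  have h3 : mFourierCoeff v 0 = ∫ x, powMap (q / 2) (trigPoly S c x) ∂torusMeasure d := by
    refine integral_congr_ae (Eventually.of_forall fun x => ?_)
    simp [mFourier_zero, v]
  have h4 := integral_rpow_le_two_mul_variance hq (trigPoly S c).continuous (integral_trigPoly S c)
  rw [← h3] at h4
  simp only [h2] at h1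
  -- Deleting the zero mode from Parseval leaves the variance of `v`. The other modes have symbol at
  -- least `4π²`, and `4 · 4π² · 1/2` gives the constant `8π²`.
  have h5 := h1.update 0 0
  have h6 : ∀ T : Finset (Fin d → ℤ), ∑ n ∈ T,
      Function.update (fun n => ‖mFourierCoeff v n‖ ^ 2) 0 0 n ≤
        R / (4 * (q - 1) / q ^ 2 * (4 * Real.pi ^ 2)) := by
    intro T
    rw [le_div_iff₀ (by positivity)]
    refine le_trans ?_ (sum_laplaceSymbol_mul_le_integral hq S c (v := v) (fun x => rfl) T)
    rw [mul_comm, mul_assoc, Finset.mul_sum]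
    refine mul_le_mul_of_nonneg_left (Finset.sum_le_sum fun n _ => ?_) (by positivity)
    rcases eq_or_ne n 0 with rfl | hn
    · rw [Function.update_self, mul_zero]
      exact mul_nonneg (laplaceSymbol_nonneg _) (sq_nonneg _)
    · rw [Function.update_of_ne hn]
      exact mul_le_mul_of_nonneg_right (four_pi_sq_le_laplaceSymbol hn) (sq_nonneg _)
  have h7 := le_of_tendsto h5 (Eventually.of_forall h6)
  rw [le_div_iff₀ (by positivity)] at h7
  have h8 : 0 ≤ 8 * Real.pi ^ 2 * ((q - 1) / q ^ 2) := by positivity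
  refine (mul_le_mul_of_nonneg_left h4 h8).trans (le_trans (le_of_eq ?_) h7)
  ring

theorem norm_sum_trigLp {q : ℝ} (hq : 1 < q) [Fact (1 ≤ ENNReal.ofReal q)]
    (S : Finset {n : Fin d → ℤ // n ≠ 0}) (c : {n : Fin d → ℤ // n ≠ 0} → ℂ) :
    ‖∑ n ∈ S, c n • trigLp (ENNReal.ofReal q) n‖ =
      (∫ x, ‖trigPoly S c x‖ ^ q ∂torusMeasure d) ^ (1 / q) := by
  have h1 : ∑ n ∈ S, c n • trigLp (ENNReal.ofReal q) n =
      ContinuousMap.toLp (ENNReal.ofReal q) (torusMeasure d) ℂ (trigPoly S c) := by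
    simp only [trigPoly, map_sum, map_smul, trigLp]
  have h2 := ContinuousMap.coeFn_toLp (p := ENNReal.ofReal q) (𝕜 := ℂ) (torusMeasure d)
    (trigPoly S c)
  have hm : MemLp (trigPoly S c) (ENNReal.ofReal q) (torusMeasure d) :=
    (memLp_congr_ae h2).mp (Lp.memLp _)
  have hq0 : (0 : ℝ) < q := by linarith
  rw [h1, Lp.norm_def, eLpNorm_congr_ae h2,
    hm.eLpNorm_eq_integral_rpow_norm (by simpa using hq0) ENNReal.ofReal_ne_top,
    ENNReal.toReal_ofReal hq0.le, ENNReal.toReal_ofReal (by positivity), one_div]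

/-- The `L^q` bound for the resolvent of the Laplacian. -/
theorem multiplierBound_resolvent {q : ℝ} (hq : 1 < q) [Fact (1 ≤ ENNReal.ofReal q)]
    {s : ℝ} (hs : 0 ≤ s) :
    MultiplierBound (trigLp (d := d) (ENNReal.ofReal q))
      (1 + s * (8 * Real.pi ^ 2 * ((q - 1) / q ^ 2)))⁻¹
      (fun n => ((1 + s * laplaceSymbol n.1)⁻¹ : ℝ)) := by
  intro S c
  have hq0 : (0 : ℝ) < q := by linarith
  have hq1 : 0 < q - 1 := by linarith
  set κ := 8 * Real.pi ^ 2 * ((q - 1) / q ^ 2) with hκ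
  have hκ0 : 0 ≤ κ := by positivity
  -- `b` solves `c = b + s(-Δ)b`. Pairing this equation with `|b|^{q-2} b` brings in the dissipation
  -- (`h1`), and Hölder bounds the pairing from above (`h2`).
  set b : {n : Fin d → ℤ // n ≠ 0} → ℂ :=
    fun n => ((1 + s * laplaceSymbol n.1)⁻¹ : ℝ) * c n with hb
  have hc : ∀ n, c n = b n + s * (laplaceSymbol n.1 * b n) := fun n => by
    have h1 : (1 + s * laplaceSymbol n.1) ≠ 0 :=
      (add_pos_of_pos_of_nonneg one_pos (mul_nonneg hs (laplaceSymbol_nonneg _))).ne'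
    have h2 : ((1 + s * laplaceSymbol n.1 : ℝ) : ℂ) * ((1 + s * laplaceSymbol n.1 : ℝ) : ℂ)⁻¹ = 1 :=
      mul_inv_cancel₀ (by exact_mod_cast h1)
    simp only [hb]
    push_cast at h2 ⊢
    linear_combination (-c n) * h2
  rw [norm_sum_trigLp hq, norm_sum_trigLp hq]
  have hJ : Continuous fun x => powMap (q - 1) (trigPoly S b x) :=
    (continuous_powMap hq1).comp (trigPoly S b).continuous
  have hN : Continuous fun x => ‖trigPoly S b x‖ ^ q :=
    (trigPoly S b).continuous.norm.rpow_const fun _ => Or.inr hq0.le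
  have hN1 : Continuous fun x => ‖trigPoly S b x‖ ^ (q - 1) :=
    (trigPoly S b).continuous.norm.rpow_const fun _ => Or.inr hq1.le
  have hdec : ∀ x, trigPoly S c x = trigPoly S b x +
      s • trigPoly S (fun n => (laplaceSymbol n.1 : ℂ) * b n) x := fun x => by
    simp only [trigPoly_apply, Finset.smul_sum, ← Finset.sum_add_distrib, Complex.real_smul]
    refine Finset.sum_congr rfl fun n _ => ?_
    rw [hc n]; ring
  set X := ∫ x, ‖trigPoly S b x‖ ^ q ∂torusMeasure d with hX
  set Y := ∫ x, ‖trigPoly S c x‖ ^ q ∂torusMeasure d with hY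
  have hX0 : 0 ≤ X := integral_nonneg fun x => by positivity
  have hY0 : 0 ≤ Y := integral_nonneg fun x => by positivity
  have h1 : (1 + s * κ) * X ≤
      ∫ x, inner ℝ (trigPoly S c x) (powMap (q - 1) (trigPoly S b x)) ∂torusMeasure d := by
    have h2 := mul_integral_rpow_le_dissipation hq S b
    simp only [hdec, inner_add_left, real_inner_smul_left, inner_powMap_self hq]
    rw [integral_add, integral_const_mul]
    · have := mul_le_mul_of_nonneg_left h2 hs
      rw [← hX] at this ⊢
      linarith
    all_goals exact integrable_of_continuous (by fun_prop)
  have h2 : ∫ x, inner ℝ (trigPoly S c x) (powMap (q - 1) (trigPoly S b x)) ∂torusMeasure d ≤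
      Y ^ (1 / q) * X ^ (1 - 1 / q) := by
    have hpq : q.HolderConjugate (q / (q - 1)) := Real.HolderConjugate.conjExponent hq
    have hcm : ∀ (f : UnitAddTorus (Fin d) → ℝ) (p : ℝ≥0∞), Continuous f →
        MemLp f p (torusMeasure d) := fun f p hf =>
      hf.memLp_of_hasCompactSupport (HasCompactSupport.of_compactSpace f)
    have h3 := integral_mul_le_Lp_mul_Lq_of_nonneg (μ := torusMeasure d) hpq
      (f := fun x => ‖trigPoly S c x‖) (g := fun x => ‖trigPoly S b x‖ ^ (q - 1))
      (Eventually.of_forall fun x => norm_nonneg _)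
      (Eventually.of_forall fun x => by positivity)
      (hcm _ _ (by fun_prop)) (hcm _ _ hN1)
    have h4 : ∀ x, (‖trigPoly S b x‖ ^ (q - 1)) ^ (q / (q - 1)) = ‖trigPoly S b x‖ ^ q :=
      fun x => by
        rw [← Real.rpow_mul (norm_nonneg _)]
        congr 1
        field_simp
    simp only [h4] at h3
    have h5 : 1 / (q / (q - 1)) = 1 - 1 / q := by field_simp
    rw [h5] at h3
    refine le_trans (integral_mono (integrable_of_continuous (by fun_prop))
      (integrable_of_continuous (by fun_prop)) fun x => ?_) h3
    exact (real_inner_le_norm _ _).trans_eq (by rw [norm_powMap hq1])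
  rw [inv_mul_eq_div, le_div_iff₀ (by positivity)]
  -- The final step cancels `X ^ (1 - 1 / q)`, which requires `X > 0`.
  rcases hX0.eq_or_lt with hX1 | hX1
  · rw [← hX1, Real.zero_rpow (by positivity), zero_mul]
    positivity
  · have h3 : X = X ^ (1 / q) * X ^ (1 - 1 / q) := by
      rw [← Real.rpow_add hX1, add_sub_cancel, Real.rpow_one]
    have h4 := h1.trans h2
    rw [h3] at h4
    have h5 : 0 < X ^ (1 - 1 / q) := Real.rpow_pos_of_pos hX1 _
    refine le_of_mul_le_mul_right ?_ h5
    rw [← h3] at h4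
    calc X ^ (1 / q) * (1 + s * κ) * X ^ (1 - 1 / q)
        = (1 + s * κ) * (X ^ (1 / q) * X ^ (1 - 1 / q)) := by ring
      _ = (1 + s * κ) * X := by rw [← h3]
      _ ≤ _ := h4

/-- Euler's implicit scheme: `(1 + tλ/k)^{-k} → e^{-tλ}`, and the same limit turns the resolvent
norms into the decay rate. No `L^q` norm is differentiated in time. -/
theorem multiplierBound_heat_decay {q : ℝ} (hq : 1 < q) [Fact (1 ≤ ENNReal.ofReal q)]
    {t : ℝ} (ht : 0 ≤ t) :
    MultiplierBound (trigLp (d := d) (ENNReal.ofReal q))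
      (Real.exp (-(8 * Real.pi ^ 2 * ((q - 1) / q ^ 2) * t)))
      (fun n => (Real.exp (-(t * laplaceSymbol n.1)) : ℂ)) := by
  have hq1 : 0 < q - 1 := by linarith
  have hlim : ∀ z : ℝ, Tendsto (fun k : ℕ => ((1 + t / k * z)⁻¹) ^ k) atTop
      (𝓝 (Real.exp (-(t * z)))) := fun z => by
    have h := (Real.tendsto_one_add_div_pow_exp (t * z)).inv₀ (Real.exp_pos _).ne'
    rw [← Real.exp_neg] at h
    refine h.congr fun k => ?_
    rw [inv_pow, div_mul_eq_mul_div]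
  refine MultiplierBound.of_tendsto (l := atTop)
    (K := fun k : ℕ => ((1 + t / k * (8 * Real.pi ^ 2 * ((q - 1) / q ^ 2)))⁻¹) ^ k)
    (M := fun (k : ℕ) => (fun n : {n : Fin d → ℤ // n ≠ 0} =>
      (((1 + t / k * laplaceSymbol n.1)⁻¹ : ℝ) : ℂ)) ^ k) ?_ (fun n => ?_)
    (Eventually.of_forall fun k => ?_)
  · rw [mul_comm _ t]
    exact hlim _
  · refine ((Complex.continuous_ofReal.tendsto _).comp (hlim (laplaceSymbol n.1))).congr fun k => ?_
    simp
  · exact (multiplierBound_resolvent hq (by positivity)).pow (by positivity) k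

end Resolvent

/-! ### From trigonometric polynomials to all of `L^q` -/

section Extension

open Filter Topology UnitAddTorus

/-- If `K < r`, Chebyshev gives `μ {r ≤ ‖f‖} ≤ (K / r) ^ p` for every `p ≥ 1`, so this set is null.
-/
theorem eLpNorm_top_le_of_forall_nat {X E : Type*} [MeasurableSpace X] [NormedAddCommGroup E]
    {μ : Measure X} {f : X → E} (hf : AEStronglyMeasurable f μ) {K : ℝ≥0∞}
    (h : ∀ p : ℕ, 1 ≤ p → eLpNorm f p μ ≤ K) : eLpNorm f ∞ μ ≤ K := by
  rw [eLpNorm_exponent_top]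
  by_contra hK
  obtain ⟨r, hKr, hr⟩ := exists_between (not_le.mp hK)
  have hr0 : r ≠ 0 := (bot_le.trans_lt hKr).ne'
  have hrt : r ≠ ∞ := (hr.trans_le le_top).ne
  have hratio : r⁻¹ * K < 1 := by
    rw [mul_comm, ← div_eq_mul_inv]
    exact (ENNReal.div_lt_iff (Or.inl hr0) (Or.inl hrt)).mpr (by rwa [one_mul])
  have h1 : ∀ p : ℕ, 1 ≤ p → μ {x | r ≤ ‖f x‖ₑ} ≤ (r⁻¹ * K) ^ p := by
    intro p hp
    have h2 := meas_ge_le_mul_pow_eLpNorm_enorm μ (p := p) (by simp; omega) (by simp) hf hr0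
      (fun hh => absurd hh hrt)
    refine h2.trans ?_
    rw [ENNReal.toReal_natCast, ENNReal.rpow_natCast, ENNReal.rpow_natCast, ← mul_pow]
    gcongr
    exact h p hp
  have h2 : μ {x | r ≤ ‖f x‖ₑ} ≤ 0 :=
    ge_of_tendsto (ENNReal.tendsto_pow_atTop_nhds_zero_of_lt_one hratio)
      ((eventually_ge_atTop 1).mono fun p hp => h1 p hp)
  have h3 : eLpNormEssSup f μ ≤ r := by
    refine essSup_le_of_ae_le r ?_
    have h4 : ∀ᵐ x ∂μ, ¬ r ≤ ‖f x‖ₑ := by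
      rw [ae_iff]
      simpa using h2
    exact h4.mono fun x hx => (not_le.mp hx).le
  exact absurd hr (not_lt.mpr h3)

variable {d : ℕ} {α t : ℝ}

theorem hasSum_fracHeat (hα : 0 < α) (ht : 0 < t) (f : UnitAddTorus (Fin d) → ℂ) :
    ∃ F : C(UnitAddTorus (Fin d), ℂ), (⇑F = fracHeat α t f) ∧
      HasSum (fun n => ((heatSymbol α t n : ℂ) * mFourierCoeff f n) • mFourier n) F := by
  have hs := (summable_norm_fracHeat hα ht f).of_norm
  refine ⟨_, ?_, hs.hasSum⟩
  funext x
  exact (ContinuousMap.hasSum_apply hs.hasSum x).tsum_eq.symm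

section Lp

variable (q : ℝ≥0∞) [Fact (1 ≤ q)]

/-- The operator is a norm-convergent sum of rank-one operators. It agrees almost everywhere with
the pointwise series because that series converges uniformly. -/
theorem exists_fracHeatCLM (hα : 0 < α) (ht : 0 < t) :
    ∃ T : Lp ℂ q (torusMeasure d) →L[ℂ] Lp ℂ q (torusMeasure d),
      (∀ g, T g =ᵐ[torusMeasure d] fracHeat α t g) ∧
      ∀ n, T (monoLp q n) = (heatSymbol α t n : ℂ) • monoLp q n := by
  let A : (Fin d → ℤ) → Lp ℂ q (torusMeasure d) →L[ℂ] Lp ℂ q (torusMeasure d) :=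
    fun n => (heatSymbol α t n : ℂ) • (coeffCLM q n).smulRight (monoLp q n)
  have hA : ∀ n g, A n g = ((heatSymbol α t n : ℂ) * mFourierCoeff g n) • monoLp q n := fun n g => by
    rw [mul_smul]; rfl
  have hsum : Summable A := by
    refine Summable.of_norm_bounded (summable_heatSymbol hα ht) fun n => ?_
    refine ContinuousLinearMap.opNorm_le_bound _ (heatSymbol_pos α t n).le fun g => ?_
    rw [hA, norm_smul, norm_mul, Complex.norm_real, Real.norm_of_nonneg (heatSymbol_pos α t n).le]
    refine (mul_le_of_le_one_right (mul_nonneg (heatSymbol_pos α t n).le (norm_nonneg _))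
      (norm_monoLp_le q n)).trans ?_
    exact mul_le_mul_of_nonneg_left (norm_coeffCLM_apply_le q n g) (heatSymbol_pos α t n).le
  have hT : ∀ g, HasSum (fun n => A n g) ((∑' n, A n) g) := fun g =>
    hsum.hasSum.mapL (ContinuousLinearMap.apply ℂ _ g)
  refine ⟨∑' n, A n, fun g => ?_, fun m => ?_⟩
  · obtain ⟨F, hF, hFs⟩ := hasSum_fracHeat hα ht (g : UnitAddTorus (Fin d) → ℂ)
    have h1 := hFs.mapL (ContinuousMap.toLp q (torusMeasure d) ℂ)
    have h2 := hT g
    simp only [hA] at h2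
    simp only [map_smul] at h1
    rw [h2.unique h1, ← hF]
    exact ContinuousMap.coeFn_toLp _ _
  · refine (hT (monoLp q m)).unique ?_
    convert hasSum_single m fun n hn => ?_ using 1
    · rw [hA, ← coeffCLM_apply, monoLp, coeffCLM_toLp_mFourier, if_pos rfl, mul_one]
    · rw [hA, ← coeffCLM_apply, monoLp, coeffCLM_toLp_mFourier, if_neg (Ne.symm hn), mul_zero,
        zero_smul]

theorem eLpNorm_fracHeat_le_of_multiplierBound (hq : q ≠ ∞) (hα : 0 < α) (ht : 0 < t) {κ : ℝ}
    (h : MultiplierBound (trigLp (d := d) q) κ (fun n => (heatSymbol α t n.1 : ℂ)))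
    {f : UnitAddTorus (Fin d) → ℂ} (hf : MemLp f q (torusMeasure d))
    (hmean : mFourierCoeff f 0 = 0) :
    MemLp (fracHeat α t f) q (torusMeasure d) ∧
      eLpNorm (fracHeat α t f) q (torusMeasure d) ≤
        ENNReal.ofReal κ * eLpNorm f q (torusMeasure d) := by
  obtain ⟨T, hT, hTe⟩ := exists_fracHeatCLM (d := d) q hα ht
  -- `P` removes the mean, so the estimate for `T ∘ P` can be stated on the whole space, where
  -- monomials span a dense subspace; it is a closed condition.
  let P : Lp ℂ q (torusMeasure d) →L[ℂ] Lp ℂ q (torusMeasure d) :=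
    ContinuousLinearMap.id ℂ _ - (coeffCLM q 0).smulRight (monoLp q 0)
  have hP : ∀ g, P g = g - coeffCLM q 0 g • monoLp q 0 := fun g => rfl
  have hP0 : P (monoLp q 0) = 0 := by
    rw [hP]
    nth_rewrite 2 [monoLp]
    rw [coeffCLM_toLp_mFourier, if_pos rfl, one_smul, sub_self]
  have hPn : ∀ n : Fin d → ℤ, n ≠ 0 → P (monoLp q n) = monoLp q n := fun n hn => by
    rw [hP]
    nth_rewrite 2 [monoLp]
    rw [coeffCLM_toLp_mFourier, if_neg hn, zero_smul, sub_zero]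
  have hcl : IsClosed {g | ‖T (P g)‖ ≤ κ * ‖P g‖} :=
    isClosed_le (by fun_prop) (by fun_prop)
  have hspan : ∀ g ∈ Submodule.span ℂ (Set.range (monoLp (d := d) q)),
      ‖T (P g)‖ ≤ κ * ‖P g‖ := by
    intro g hg
    obtain ⟨c, rfl⟩ := (Finsupp.mem_span_range_iff_exists_finsupp).mp hg
    have h1 : P (c.sum fun i a => a • monoLp q i) =
        ∑ n ∈ c.support.subtype (· ≠ 0), c n.1 • trigLp q n := by
      have h0 : ∑ n ∈ c.support.subtype (· ≠ 0), c n.1 • trigLp q n =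
          ∑ n ∈ c.support with n ≠ 0, c n • monoLp q n :=
        Finset.sum_subtype_eq_sum_filter (fun n => c n • monoLp q n)
      rw [h0, Finsupp.sum, map_sum, Finset.sum_filter]
      refine Finset.sum_congr rfl fun n _ => ?_
      rw [map_smul]
      split_ifs with hn
      · rw [hPn n hn]
      · rw [not_not.mp hn, hP0, smul_zero]
    have h2 : T (∑ n ∈ c.support.subtype (· ≠ 0), c n.1 • trigLp q n) =
        ∑ n ∈ c.support.subtype (· ≠ 0), ((heatSymbol α t n.1 : ℂ) * c n.1) • trigLp q n := by
      rw [map_sum]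
      refine Finset.sum_congr rfl fun n _ => ?_
      have := hTe n.1
      rw [map_smul, mul_comm, mul_smul]
      exact congrArg _ this
    rw [h1, h2]
    exact h _ fun n => c n.1
  have hdense : (Submodule.span ℂ (Set.range (monoLp (d := d) q))).topologicalClosure = ⊤ :=
    span_mFourierLp_closure_eq_top hq
  have hall : ∀ g, ‖T (P g)‖ ≤ κ * ‖P g‖ := fun g => by
    have hg : g ∈ (Submodule.span ℂ (Set.range (monoLp (d := d) q))).topologicalClosure := by
      rw [hdense]; trivial
    exact closure_minimal hspan hcl hg
  have hfg := hf.coeFn_toLp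
  have hcoef : ∀ n, mFourierCoeff (hf.toLp f) n = mFourierCoeff f n :=
    mFourierCoeff_congr_ae hfg
  have hfrac : fracHeat α t (hf.toLp f) = fracHeat α t f := by
    funext x
    simp only [fracHeat, hcoef]
  have hPf : P (hf.toLp f) = hf.toLp f := by
    rw [hP, coeffCLM_apply, hcoef, hmean, zero_smul, sub_zero]
  have h1 := hall (hf.toLp f)
  have h2 := hT (hf.toLp f)
  rw [hfrac] at h2
  rw [hPf] at h1
  refine ⟨(memLp_congr_ae h2).mp (Lp.memLp _), ?_⟩
  rw [← eLpNorm_congr_ae h2, ← eLpNorm_congr_ae hfg, ← ENNReal.ofReal_toReal (Lp.eLpNorm_ne_top _),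
    ← ENNReal.ofReal_toReal (Lp.eLpNorm_ne_top (hf.toLp f)), ← Lp.norm_def, ← Lp.norm_def,
    ← ENNReal.ofReal_mul' (norm_nonneg _)]
  exact ENNReal.ofReal_le_ofReal h1

end Lp

/-- Density fails in `L^∞`, so the bound is the limit of those for finite `p`. This needs one `κ`
for all exponents, and `‖f‖_p ≤ ‖f‖_∞` on a probability space. -/
theorem eLpNorm_top_fracHeat_le (hα : 0 < α) (ht : 0 < t) {κ : ℝ}
    (h : ∀ (q : ℝ≥0∞) [Fact (1 ≤ q)],
      MultiplierBound (trigLp (d := d) q) κ (fun n => (heatSymbol α t n.1 : ℂ)))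
    {f : UnitAddTorus (Fin d) → ℂ} (hf : MemLp f ∞ (torusMeasure d))
    (hmean : mFourierCoeff f 0 = 0) :
    MemLp (fracHeat α t f) ∞ (torusMeasure d) ∧
      eLpNorm (fracHeat α t f) ∞ (torusMeasure d) ≤
        ENNReal.ofReal κ * eLpNorm f ∞ (torusMeasure d) := by
  obtain ⟨F, hF, -⟩ := hasSum_fracHeat hα ht f
  have hm : AEStronglyMeasurable (fracHeat α t f) (torusMeasure d) := by
    rw [← hF]; exact F.continuous.aestronglyMeasurable
  have hle : eLpNorm (fracHeat α t f) ∞ (torusMeasure d) ≤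
        ENNReal.ofReal κ * eLpNorm f ∞ (torusMeasure d) := by
    refine eLpNorm_top_le_of_forall_nat hm fun p hp => ?_
    have hp1 : (1 : ℝ≥0∞) ≤ p := by exact_mod_cast hp
    have : Fact ((1 : ℝ≥0∞) ≤ p) := ⟨hp1⟩
    refine (eLpNorm_fracHeat_le_of_multiplierBound (p : ℝ≥0∞) (by simp) hα ht (h p)
      (hf.mono_exponent le_top) hmean).2.trans ?_
    gcongr
    exact eLpNorm_le_eLpNorm_of_exponent_le le_top hf.1
  exact ⟨⟨hm, hle.trans_lt (ENNReal.mul_lt_top ENNReal.ofReal_lt_top hf.2)⟩, hle⟩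

end Extension

end PeriodicHeat

/-! ### Assembly of the two estimates -/

theorem theorem1p3 :
    (∀ d : ℕ, 1 ≤ d → ∀ α : ℝ, 0 < α → α < 2 →
      ∃ c₁ : ℝ, 0 < c₁ ∧
        ∀ q : ℝ≥0∞, 1 ≤ q → ∀ f : UnitAddTorus (Fin d) → ℂ,
          MemLp f q (PeriodicHeat.torusMeasure d) →
          UnitAddTorus.mFourierCoeff f 0 = 0 →
          ∀ t : ℝ, 0 < t →
            MemLp (PeriodicHeat.fracHeat α t f) q (PeriodicHeat.torusMeasure d) ∧
            eLpNorm (PeriodicHeat.fracHeat α t f) q (PeriodicHeat.torusMeasure d) ≤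
              ENNReal.ofReal (Real.exp (-(c₁ * t))) *
                eLpNorm f q (PeriodicHeat.torusMeasure d)) ∧
    (∃ c₂ : ℝ, 0 < c₂ ∧
      ∀ d : ℕ, 1 ≤ d → ∀ q : ℝ, 1 < q → ∀ f : UnitAddTorus (Fin d) → ℂ,
        MemLp f (ENNReal.ofReal q) (PeriodicHeat.torusMeasure d) →
        UnitAddTorus.mFourierCoeff f 0 = 0 →
        ∀ t : ℝ, 0 < t →
          MemLp (PeriodicHeat.fracHeat 2 t f) (ENNReal.ofReal q)
            (PeriodicHeat.torusMeasure d) ∧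
          eLpNorm (PeriodicHeat.fracHeat 2 t f) (ENNReal.ofReal q)
              (PeriodicHeat.torusMeasure d) ≤
            ENNReal.ofReal (Real.exp (-(c₂ * ((q - 1) / q ^ 2) * t))) *
              eLpNorm f (ENNReal.ofReal q) (PeriodicHeat.torusMeasure d)) := by
  refine ⟨fun d _ α hα hα2 => ?_, 8 * Real.pi ^ 2, by positivity,
    fun d _ q hq f hf hmean t ht => ?_⟩
  · obtain ⟨c, hc, hbound⟩ := PeriodicHeat.exists_multiplierBound_fracHeat (β := α / 2) d
      (by positivity) (by linarith)
    have key : ∀ t : ℝ, 0 < t → ∀ (q : ℝ≥0∞) [Fact (1 ≤ q)],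
        PeriodicHeat.MultiplierBound (PeriodicHeat.trigLp (d := d) q) (Real.exp (-(c * t)))
          (fun n => (PeriodicHeat.heatSymbol α t n.1 : ℂ)) := fun t ht q _ => by
      simpa only [PeriodicHeat.heatSymbol_eq_rpow] using hbound q t ht.le
    refine ⟨c, hc, fun q hq f hf hmean t ht => ?_⟩
    have : Fact (1 ≤ q) := ⟨hq⟩
    rcases eq_or_ne q ∞ with rfl | hq'
    · exact PeriodicHeat.eLpNorm_top_fracHeat_le hα ht (fun q _ => key t ht q) hf hmean
    · exact PeriodicHeat.eLpNorm_fracHeat_le_of_multiplierBound q hq' hα ht (key t ht q) hf hmean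
  · have : Fact (1 ≤ ENNReal.ofReal q) := ⟨by
      rw [← ENNReal.ofReal_one]; exact ENNReal.ofReal_le_ofReal hq.le⟩
    refine PeriodicHeat.eLpNorm_fracHeat_le_of_multiplierBound _ ENNReal.ofReal_ne_top two_pos ht
      ?_ hf hmean
    simpa only [PeriodicHeat.heatSymbol_two] using
      PeriodicHeat.multiplierBound_heat_decay (d := d) hq ht.le
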